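/- Let $n\ge 2$ and let $D_1,\dots,D_n$ be pairwise disjoint closed disks in the plane, $D_i$ having center $c_i$, radius $R_i>0$ and weight $\omega_i\in[0,\pi/2]$; the weight outside the disks is $1$. The weighted length $\lVert\Pi\rVert$ of a rectifiable path $\Pi$ is its length outside the disks, plus, for each $i$, $\omega_i$ times its length in the interior of $D_i$ and $\min\{1,\omega_i\}$ times its length along the boundary of $D_i$. Let $d_i$ be the least distance from $D_i$ to another disk, $c=\frac{\pi}{2}\,\frac{\max_j R_j}{\min_j d_j}$, $a=\frac12\bigl(1+3c+\sqrt{9c^2+10c+1}\bigr)$ and $\alpha_i=\arcsin\frac{\min\{d_i,R_i\}\min\{1,\omega_i\}}{4R_i\max\{1,\omega_i\}}$. Let $\varepsilon>0$ with $\varepsilon\le\frac{a\pi}{2\omega_i}$ whenever $\omega_i>0$ (for instance any $\varepsilon\in(0,1]$). Place points on the boundary of each $D_i$, starting at an arbitrary angular position, as follows. * If $\omega_i=0$: vertex vicinity centers $v_i^1,\dots,v_i^{k_i}$, consecutive ones at central angle $\frac{\varepsilon d_i}{a(d_i+1)}$, as many as fit in an angle less than $2\pi$ counted from $v_i^1$.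 * If $\omega_i>0$: $k_i=\lfloor\frac{\pi}{2\alpha_i}\rfloor$ equally spaced vertex vicinity centers $v_i^j$ and, for each of them, ring points: the point $p^0$ diametrically opposed to $v_i^j$ and, on each of the two half circles, points $p^1,\dots,p^r$ with $\angle p^{\ell}v_i^jp^{\ell+1}=\frac{\omega_i\varepsilon}{a}\bigl(1-\frac{2\omega_i\varepsilon}{a\pi}\bigr)^{\ell}$, where $r$ is the largest integer with $\angle p^0v_i^jp^r\le\frac{\pi}{2}-\alpha_i$. The nodes are all vertex vicinity centers together with the ring points; any of the ring points of $v_i^j$ that are farther from $v_i^j$ than its neighboring vertex vicinity centers, i.e. at distance more than $2R_i\sin(\pi/k_i)$, may be omitted. Let $G_\varepsilon$ be the complete graph on the nodes, where the weight of the edge $uv$ is the weighted length of: the boundary arc between $u$ and $v$, if they are adjacent nodes on the same disk; the chord $uv$, if they are on the same disk but not adjacent; the segment $uv$, if they are on different disks and the segment meets the interior of no disk; and otherwise a shortest path (with respect to weighted length) from $u$ to $v$ among the paths avoiding the interiors of all disks. Then, for any two nodes $s$ and $t$, there is a path $\tilde\pi(s,t)$ in $G_\varepsilon$ such that $\lVert\tilde\pi(s,t)\rVert\le(1+\varepsilon)\,\lVert\Pi\rVert$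 for every rectifiable path $\Pi$ from $s$ to $t$; in particular $\lVert\tilde\pi(s,t)\rVert\le(1+\varepsilon)\,\lVert \mathit{SP_w}(s,t)\rVert$ for a weighted shortest path $\mathit{SP_w}(s,t)$ between $s$ and $t$. -/

import Mathlib

open Real

noncomputable section

/-- `n` pairwise disjoint closed disks in the Euclidean plane `ℂ`, with nonnegative weights.
The weight of the region outside the disks is `1`. -/
structure WeightedDisks (n : ℕ) where
  center : Fin n → ℂ
  radius : Fin n → ℝ
  weight : Fin n → ℝ
  radius_pos : ∀ i, 0 < radius i
  weight_nonneg : ∀ i, 0 ≤ weight i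
  disjoint : ∀ i j, i ≠ j →
    Disjoint (Metric.closedBall (center i) (radius i)) (Metric.closedBall (center j) (radius j))

/-- A rectifiable path in the plane: a continuous curve, parametrized by `[0, 1]` and extended by
constants to `ℝ`, of finite length. -/
structure RectifiablePath (x y : ℂ) extends Path x y where
  rectifiable : BoundedVariationOn toPath.extend Set.univ

/-- The arc-length measure of a rectifiable path on the parameter line: an interval of parameters
has as its measure the Euclidean length of the corresponding portion of the path. -/
def RectifiablePath.arcLength {x y : ℂ} (γ : RectifiablePath x y) : MeasureTheory.Measure ℝ :=
  (γ.rectifiable.stieltjesFunctionRightLim 0).measure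

namespace WeightedDisks

variable {n : ℕ} (S : WeightedDisks n)

/-! ### Weighted length of a path -/

/-- The weighted length of a path: length outside the disks, plus `ω i` times the length in the
interior of the `i`-th disk, plus `min 1 (ω i)` times the length along its boundary circle. -/
def weightedLength {x y : ℂ} (γ : RectifiablePath x y) : ENNReal :=
  γ.arcLength {τ | ∀ i, γ.toPath.extend τ ∉ Metric.closedBall (S.center i) (S.radius i)} +
    ∑ i, (ENNReal.ofReal (S.weight i) *
        γ.arcLength {τ | γ.toPath.extend τ ∈ Metric.ball (S.center i) (S.radius i)} +
      ENNReal.ofReal (min 1 (S.weight i)) *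
        γ.arcLength {τ | γ.toPath.extend τ ∈ Metric.sphere (S.center i) (S.radius i)})

/-! ### Steiner points -/

/-- The least distance `d i` from the `i`-th disk to another disk. The distance between disjoint
disks is the distance between their centers minus the two radii. -/
def gap (i : Fin n) : ℝ :=
  ⨅ j : {j : Fin n // j ≠ i}, (dist (S.center i) (S.center j) - S.radius i - S.radius j)

/-- The constant `c = (π / 2) (max R) / (min d)`. -/
def cConst : ℝ := (π / 2) * (⨆ i, S.radius i) / (⨅ i, S.gap i)

/-- The constant `a = (1 + 3 c + √(9 c² + 10 c + 1)) / 2`. -/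
def aConst : ℝ := (1 + 3 * S.cConst + √(9 * S.cConst ^ 2 + 10 * S.cConst + 1)) / 2

/-- The weighted angular radius `α i`. -/
def angularRadius (i : Fin n) : ℝ :=
  arcsin (min (S.gap i) (S.radius i) * min 1 (S.weight i) /
    (4 * S.radius i * max 1 (S.weight i)))

/-- The point at angle `θ` on the boundary circle of the `i`-th disk. -/
def pt (i : Fin n) (θ : ℝ) : ℂ := circleMap (S.center i) (S.radius i) θ

/-- The number `⌊π / (2 α i)⌋` of vertex vicinity centers on a disk of positive weight. -/
def numCenters (i : Fin n) : ℕ := ⌊π / (2 * S.angularRadius i)⌋₊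

/-- The central angle `ε d / (a (d + 1))` between consecutive vertex vicinity centers on a disk of
weight zero. -/
def zeroStep (ε : ℝ) (i : Fin n) : ℝ := ε * S.gap i / (S.aConst * (S.gap i + 1))

open Classical in
/-- The angular positions of the vertex vicinity centers on the `i`-th disk, where `θ₀ i` is the
position of the first one. -/
def centerAngles (ε : ℝ) (θ₀ : Fin n → ℝ) (i : Fin n) : Set ℝ :=
  if S.weight i = 0 then
    {φ | ∃ l : ℕ, l * S.zeroStep ε i < 2 * π ∧ φ = θ₀ i + l * S.zeroStep ε i}
  else
    {φ | ∃ j : ℕ, j < S.numCenters i ∧ φ = θ₀ i + 2 * π * j / S.numCenters i}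

/-- The vertex vicinity centers on the `i`-th disk. -/
def vicinityCenters (ε : ℝ) (θ₀ : Fin n → ℝ) (i : Fin n) : Set ℂ :=
  S.pt i '' S.centerAngles ε θ₀ i

/-- The angle at a vertex vicinity center `v` between the diametrically opposed point and the
`l`-th ring point: the sum over `m < l` of the consecutive angles
`(ω ε / a) (1 - 2 ω ε / (a π)) ^ m`. -/
def ringAngle (ε : ℝ) (i : Fin n) (l : ℕ) : ℝ :=
  ∑ m ∈ Finset.range l, S.weight i * ε / S.aConst *
    (1 - 2 * S.weight i * ε / (S.aConst * π)) ^ m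

/-- The ring points associated to the vertex vicinity center at angular position `φ`, symmetric
about its diameter, with `l` running as long as the angle at the vertex vicinity center is at
most `π / 2 - α i`. The central angle is twice the inscribed angle. -/
def ringPoints (ε : ℝ) (i : Fin n) (φ : ℝ) : Set ℂ :=
  {x | ∃ l : ℕ, S.ringAngle ε i l ≤ π / 2 - S.angularRadius i ∧
    (x = S.pt i (φ + π + 2 * S.ringAngle ε i l) ∨ x = S.pt i (φ + π - 2 * S.ringAngle ε i l))}

open Classical in
/-- All Steiner points on the `i`-th disk: the vertex vicinity centers and, if the weight of the
disk is positive, all their ring points. -/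
def steinerPoints (ε : ℝ) (θ₀ : Fin n → ℝ) (i : Fin n) : Set ℂ :=
  S.vicinityCenters ε θ₀ i ∪
    {x | S.weight i ≠ 0 ∧ ∃ φ ∈ S.centerAngles ε θ₀ i, x ∈ S.ringPoints ε i φ}

/-- The Steiner points on the `i`-th disk when each vertex vicinity center keeps only those of its
ring points that are not farther away from it than its neighboring vertex vicinity centers, which
are at distance `2 R sin (π / k)`. -/
def annularSteinerPoints (ε : ℝ) (θ₀ : Fin n → ℝ) (i : Fin n) : Set ℂ :=
  S.vicinityCenters ε θ₀ i ∪
    {x | S.weight i ≠ 0 ∧ ∃ φ ∈ S.centerAngles ε θ₀ i, x ∈ S.ringPoints ε i φ ∧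
      dist x (S.pt i φ) ≤ 2 * S.radius i * sin (π / S.numCenters i)}

/-! ### The complete weighted graph on the Steiner points -/

/-- The nodes: a disk together with one of the chosen points `V i` on it. -/
abbrev Node (V : Fin n → Set ℂ) : Type := (i : Fin n) × V i

/-- `u` and `v` are the endpoints of an arc of central angle `ψ` of the `i`-th circle that has no
chosen point in its relative interior. -/
def FreeArc (V : Fin n → Set ℂ) (i : Fin n) (u v : ℂ) (ψ : ℝ) : Prop :=
  0 < ψ ∧ ∃ θ : ℝ,
    ((u = S.pt i θ ∧ v = S.pt i (θ + ψ)) ∨ (v = S.pt i θ ∧ u = S.pt i (θ + ψ))) ∧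
    ∀ χ ∈ Set.Ioo 0 ψ, S.pt i (θ + χ) ∉ V i

/-- The segment from `u` to `v` does not meet the interior of any disk. -/
def Visible (u v : ℂ) : Prop :=
  ∀ i, Disjoint (segment ℝ u v) (Metric.ball (S.center i) (S.radius i))

/-- The weighted length of a shortest path from `u` to `v` that avoids the interiors of all
disks. -/
def detourLength (u v : ℂ) : ENNReal :=
  ⨅ (γ : RectifiablePath u v)
    (_ : ∀ τ, ∀ i, γ.toPath τ ∉ Metric.ball (S.center i) (S.radius i)), S.weightedLength γ

open Classical in
/-- The weight of the edge between two distinct nodes is the weighted length of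
* the arc between them, if they are adjacent on the boundary of the same disk;
* the chord between them, if they are on the same disk but not adjacent;
* the segment between them, if they are on different disks and visible from each other;
* a shortest path between them avoiding the interiors of the disks otherwise. -/
def edgeWeight (V : Fin n → Set ℂ) (u v : Node V) : ENNReal :=
  if u.1 = v.1 then
    if ∃ ψ, S.FreeArc V u.1 u.2 v.2 ψ then
      ⨅ (ψ : ℝ) (_ : S.FreeArc V u.1 u.2 v.2 ψ),
        ENNReal.ofReal (min 1 (S.weight u.1) * (S.radius u.1 * ψ))
    else ENNReal.ofReal (S.weight u.1 * dist (u.2 : ℂ) (v.2 : ℂ))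
  else if S.Visible u.2 v.2 then ENNReal.ofReal (dist (u.2 : ℂ) (v.2 : ℂ))
  else S.detourLength u.2 v.2

/-- The weighted length of a path in the complete graph on the nodes: the sum of the weights of its
edges. -/
def graphLength {V : Fin n → Set ℂ} {s t : Node V}
    (p : (⊤ : SimpleGraph (Node V)).Walk s t) : ENNReal :=
  (p.darts.map fun e => S.edgeWeight V e.fst e.snd).sum

end WeightedDisks

end

/-! Follow an arbitrary path and cut it where it changes disks. After a time on the circle of disk
`i`, let `f` be the first time in another disk `j` and `g` the last time before `f` in disk `i`
(`exists_leave`). Up to `g` the path meets no disk but `i`; between `g` and `f` it is outside all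
disks, and this portion is at least as long as the gaps of both disks.

A portion meeting only disk `i` costs at least `crossing`, the lesser of weighted chord and boundary
arc (`crossing_le_weightedMeasure`). Excursions into the open disk cost at least their chord, short
pieces between points not in the open disk cost almost their arc, and these bounds can be added
because `crossing` is subadditive in the central angle (`crossing_le_add`).

The points at `g` and `f` are then moved to nodes. The ring points seen from a vicinity center form
a geometric progression, so every boundary point has a node within the central angle `snapAngle`
(`exists_pt_near`). The constants `a` and `α` keep the cost of one move below `ε d / 2`
(`snap_cost_le`), and the two moves are charged to the outside portion. Between the moved points,
the outside portion extended by two boundary arcs bounds the edge weight, even for a detour edge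
(`reach_outside`). Inside a disk, adjacent nodes have an arc edge instead of a chord edge; such an
arc spans at most twice `snapAngle`, so it exceeds its chord by a factor of at most `min (π / 2) (1
+ ε)` (`reach_chord`). The bound `1 + ε` is spent on the crossing, the bound `π / 2` on the
displacement.

The induction in `reach_end` runs over the changes of disk, each of which takes a minimal amount of
time by uniform continuity. As there are finitely many nodes, one shortest walk serves all paths at
once. -/

section

open MeasureTheory Set Filter Topology

/-! ### Arc-length measure of a rectifiable path -/

namespace RectifiablePath

variable {x y : ℂ} (γ : RectifiablePath x y)

theorem continuous_extend : Continuous γ.toPath.extend := γ.toPath.continuous_extend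

/-- Continuity removes the right limits from the Stieltjes function, so its increments are
variations of the path itself. -/
theorem arcLength_Ioc {a b : ℝ} (h : a ≤ b) :
    γ.arcLength (Ioc a b) = eVariationOn γ.toPath.extend (Icc a b) := by
  have hlim : Function.rightLim γ.toPath.extend = γ.toPath.extend := by
    funext z
    exact γ.continuous_extend.continuousWithinAt.rightLim_eq
  rw [arcLength, StieltjesFunction.measure_Ioc]
  simp only [BoundedVariationOn.stieltjesFunctionRightLim_apply]
  rw [← variationOnFromTo.add γ.rectifiable.rightLim.locallyBoundedVariationOn
      (mem_univ 0) (mem_univ a) (mem_univ b)]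
  simp only [add_sub_cancel_left, variationOnFromTo, h, ↓reduceIte, univ_inter, hlim]
  rw [ENNReal.ofReal_toReal]
  exact ((eVariationOn.mono _ (subset_univ _)).trans_lt γ.rectifiable.lt_top).ne

/-- The variation over `[b, a]` tends to `0` as `b → a`. Without atoms one may pass to open
intervals, where a path can avoid disks that it touches at the endpoints. -/
theorem arcLength_singleton (a : ℝ) : γ.arcLength {a} = 0 := by
  have h := γ.rectifiable.tendsto_eVariationOn_Icc_zero_left (x := a)
    γ.continuous_extend.continuousWithinAt
  simp only [univ_inter, nhdsWithin_univ] at h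
  have h' : Tendsto (fun b ↦ eVariationOn γ.toPath.extend (Icc b a)) (𝓝[<] a) (𝓝 0) :=
    h.mono_left nhdsWithin_le_nhds
  refine le_antisymm (ge_of_tendsto h' ?_) zero_le
  filter_upwards [self_mem_nhdsWithin] with b hb
  rw [← γ.arcLength_Ioc (le_of_lt hb)]
  exact measure_mono (by simpa using hb)

theorem arcLength_Ioo {a b : ℝ} (h : a ≤ b) :
    γ.arcLength (Ioo a b) = eVariationOn γ.toPath.extend (Icc a b) := by
  have : NullSingletonClass γ.arcLength := ⟨γ.arcLength_singleton⟩
  rw [← γ.arcLength_Ioc h, measure_congr Ioo_ae_eq_Ioc]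

theorem edist_le_arcLength_Ioo {a b : ℝ} (h : a ≤ b) :
    edist (γ.toPath.extend a) (γ.toPath.extend b) ≤ γ.arcLength (Ioo a b) := by
  rw [γ.arcLength_Ioo h]
  exact eVariationOn.edist_le _ (left_mem_Icc.2 h) (right_mem_Icc.2 h)

theorem arcLength_univ_le : γ.arcLength univ ≤ eVariationOn γ.toPath.extend univ := by
  have hmono : Monotone fun k : ℕ ↦ Ioc (-(k : ℝ)) k := by
    intro k l hkl
    have : (k : ℝ) ≤ l := by exact_mod_cast hkl
    exact Ioc_subset_Ioc (by linarith) this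
  have hU : (⋃ k : ℕ, Ioc (-(k : ℝ)) k) = univ := by
    refine eq_univ_of_forall fun z ↦ ?_
    obtain ⟨k, hk⟩ := exists_nat_gt |z|
    exact mem_iUnion.2 ⟨k, by linarith [(abs_lt.1 hk).1], (abs_lt.1 hk).2.le⟩
  rw [← hU, hmono.measure_iUnion]
  refine iSup_le fun k ↦ ?_
  rw [γ.arcLength_Ioc (by linarith [(Nat.cast_nonneg k : (0 : ℝ) ≤ k)]), hU]
  exact eVariationOn.mono _ (subset_univ _)

end RectifiablePath

/-! ### Weighted arc-length measure and its lower bounds -/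

namespace WeightedDisks

variable {n : ℕ} (S : WeightedDisks n) {x y : ℂ}

/-- The weighted arc-length measure of a path on the parameter line. -/
noncomputable def weightedMeasure (γ : RectifiablePath x y) : Measure ℝ :=
  γ.arcLength.restrict {τ | ∀ i, γ.toPath.extend τ ∉ Metric.closedBall (S.center i) (S.radius i)} +
    ∑ i, (ENNReal.ofReal (S.weight i) •
        γ.arcLength.restrict {τ | γ.toPath.extend τ ∈ Metric.ball (S.center i) (S.radius i)} +
      ENNReal.ofReal (min 1 (S.weight i)) •
        γ.arcLength.restrict {τ | γ.toPath.extend τ ∈ Metric.sphere (S.center i) (S.radius i)})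

theorem weightedMeasure_univ (γ : RectifiablePath x y) :
    S.weightedMeasure γ univ = S.weightedLength γ := by
  simp [weightedMeasure, weightedLength]

variable (γ : RectifiablePath x y)

theorem measurableSet_sphere (i : Fin n) : MeasurableSet
    {τ | γ.toPath.extend τ ∈ Metric.sphere (S.center i) (S.radius i)} :=
  (Metric.isClosed_sphere.preimage γ.continuous_extend).measurableSet

theorem weightedMeasure_apply {A : Set ℝ} (hA : MeasurableSet A) :
    S.weightedMeasure γ A =
      γ.arcLength (A ∩ {τ | ∀ i, γ.toPath.extend τ ∉
        Metric.closedBall (S.center i) (S.radius i)}) +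
      ∑ i, (ENNReal.ofReal (S.weight i) *
        γ.arcLength (A ∩ {τ | γ.toPath.extend τ ∈ Metric.ball (S.center i) (S.radius i)}) +
        ENNReal.ofReal (min 1 (S.weight i)) *
        γ.arcLength (A ∩ {τ | γ.toPath.extend τ ∈ Metric.sphere (S.center i) (S.radius i)})) := by
  simp [weightedMeasure, Measure.restrict_apply hA]

theorem arcLength_le_weightedMeasure {A : Set ℝ} (hA : MeasurableSet A)
    (h : ∀ τ ∈ A, ∀ i, γ.toPath.extend τ ∉ Metric.closedBall (S.center i) (S.radius i)) :
    γ.arcLength A ≤ S.weightedMeasure γ A := by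
  rw [S.weightedMeasure_apply γ hA, inter_eq_left.2 (show A ⊆ {τ | ∀ i, γ.toPath.extend τ ∉
    Metric.closedBall (S.center i) (S.radius i)} from fun τ hτ ↦ h τ hτ)]
  exact le_self_add

theorem weight_mul_arcLength_le {A : Set ℝ} (hA : MeasurableSet A) (i : Fin n)
    (h : ∀ τ ∈ A, γ.toPath.extend τ ∈ Metric.ball (S.center i) (S.radius i)) :
    ENNReal.ofReal (S.weight i) * γ.arcLength A ≤ S.weightedMeasure γ A := by
  rw [S.weightedMeasure_apply γ hA]
  refine le_add_left (le_trans ?_ (Finset.single_le_sum (fun _ _ ↦ zero_le) (Finset.mem_univ i)))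
  rw [inter_eq_left.2 (show A ⊆ {τ | γ.toPath.extend τ ∈
    Metric.ball (S.center i) (S.radius i)} from fun τ hτ ↦ h τ hτ)]
  exact le_self_add

/-- Away from the other disks the local weight is `1`, `ω i` or `min 1 (ω i)`, never below the last.
-/
theorem min_weight_mul_arcLength_le {A : Set ℝ} (hA : MeasurableSet A) (i : Fin n)
    (h : ∀ τ ∈ A, ∀ j ≠ i, γ.toPath.extend τ ∉ Metric.closedBall (S.center j) (S.radius j)) :
    ENNReal.ofReal (min 1 (S.weight i)) * γ.arcLength A ≤ S.weightedMeasure γ A := by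
  set m := ENNReal.ofReal (min 1 (S.weight i)) with hm
  have hm1 : m ≤ 1 := by
    rw [hm, ENNReal.ofReal_le_one]; exact min_le_left _ _
  have hmw : m ≤ ENNReal.ofReal (S.weight i) := ENNReal.ofReal_le_ofReal (min_le_right _ _)
  have hcover : A ⊆ (A ∩ {τ | ∀ i, γ.toPath.extend τ ∉
        Metric.closedBall (S.center i) (S.radius i)}) ∪
      ((A ∩ {τ | γ.toPath.extend τ ∈ Metric.ball (S.center i) (S.radius i)}) ∪
      (A ∩ {τ | γ.toPath.extend τ ∈ Metric.sphere (S.center i) (S.radius i)})) := by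
    intro τ hτ
    by_cases hi : γ.toPath.extend τ ∈ Metric.closedBall (S.center i) (S.radius i)
    · right
      rw [← Metric.ball_union_sphere] at hi
      exact hi.imp (fun h ↦ ⟨hτ, h⟩) (fun h ↦ ⟨hτ, h⟩)
    · left
      refine ⟨hτ, fun j ↦ ?_⟩
      rcases eq_or_ne j i with rfl | hj
      · exact hi
      · exact h τ hτ j hj
  rw [S.weightedMeasure_apply γ hA]
  calc m * γ.arcLength A
      ≤ m * (γ.arcLength (A ∩ {τ | ∀ i, γ.toPath.extend τ ∉
        Metric.closedBall (S.center i) (S.radius i)}) +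
      (γ.arcLength (A ∩ {τ | γ.toPath.extend τ ∈ Metric.ball (S.center i) (S.radius i)}) +
      γ.arcLength (A ∩ {τ | γ.toPath.extend τ ∈ Metric.sphere (S.center i) (S.radius i)}))) := by
        gcongr
        refine (measure_mono hcover).trans ((measure_union_le _ _).trans ?_)
        gcongr
        exact measure_union_le _ _
    _ ≤ _ := by
        rw [mul_add, mul_add]
        refine add_le_add (mul_le_of_le_one_left' hm1) ?_
        refine le_trans ?_ (Finset.single_le_sum (fun _ _ ↦ zero_le) (Finset.mem_univ i))
        gcongr

/-- A path avoiding the interiors of all disks is not longer when weighted. -/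
theorem weightedLength_le_eVariationOn
    (h : ∀ τ, ∀ i, γ.toPath τ ∉ Metric.ball (S.center i) (S.radius i)) :
    S.weightedLength γ ≤ eVariationOn γ.toPath.extend univ := by
  have h' : ∀ τ, ∀ i, γ.toPath.extend τ ∉ Metric.ball (S.center i) (S.radius i) := by
    intro τ i
    exact h (projIcc 0 1 zero_le_one τ) i
  refine le_trans ?_ γ.arcLength_univ_le
  have hs : ∀ i, ENNReal.ofReal (S.weight i) *
        γ.arcLength {τ | γ.toPath.extend τ ∈ Metric.ball (S.center i) (S.radius i)} +
        ENNReal.ofReal (min 1 (S.weight i)) *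
        γ.arcLength {τ | γ.toPath.extend τ ∈ Metric.sphere (S.center i) (S.radius i)} ≤
        γ.arcLength {τ | γ.toPath.extend τ ∈ Metric.sphere (S.center i) (S.radius i)} := by
    intro i
    have : {τ | γ.toPath.extend τ ∈ Metric.ball (S.center i) (S.radius i)} = ∅ := by
      ext τ; simpa using h' τ i
    rw [this, measure_empty, mul_zero, zero_add]
    exact mul_le_of_le_one_left' (by rw [ENNReal.ofReal_le_one]; exact min_le_left _ _)
  refine (add_le_add_right (Finset.sum_le_sum fun i _ ↦ hs i) _).trans ?_
  -- The circles are disjoint from each other and from the exterior, so the sum is the measure of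
  -- one union.
  rw [← measure_biUnion_finset ?_ fun i _ ↦ S.measurableSet_sphere γ i,
    ← measure_union ?_ (Finset.measurableSet_biUnion _ fun i _ ↦ S.measurableSet_sphere γ i)]
  · exact measure_mono (subset_univ _)
  · rw [Set.disjoint_left]
    intro τ hτ hτ'
    simp only [Finset.mem_univ, iUnion_true, mem_iUnion] at hτ'
    obtain ⟨i, hi⟩ := hτ'
    exact hτ i (Metric.sphere_subset_closedBall hi)
  · intro i _ j _ hij
    rw [Function.onFun, Set.disjoint_left]
    intro τ hi hj
    exact Set.disjoint_left.1 (S.disjoint i j hij) (Metric.sphere_subset_closedBall hi)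
      (Metric.sphere_subset_closedBall hj)

end WeightedDisks

end

/-! ### Inequalities for the sine and subadditivity of the crossing cost -/

section

open MeasureTheory Set Filter Topology

/-- Since `a + b` may exceed `π / 2`, monotonicity does not suffice; for `c ≥ a` the addition
formula is applied to `a + (c - a)`. -/
theorem sin_le_sin_add_sin_of_le_add {a b c : ℝ} (ha : 0 ≤ a) (hb : 0 ≤ b) (hc : c ≤ a + b)
    (hc0 : 0 ≤ c) (ha' : a ≤ π / 2) (hb' : b ≤ π / 2) :
    sin c ≤ sin a + sin b := by
  have hsa : 0 ≤ sin a := sin_nonneg_of_nonneg_of_le_pi ha (by linarith)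
  have hsb : 0 ≤ sin b := sin_nonneg_of_nonneg_of_le_pi hb (by linarith)
  rcases le_total c a with h | h
  · have := sin_le_sin_of_le_of_le_pi_div_two (by linarith) ha' h
    linarith
  · have h1 : sin (c - a) ≤ sin b :=
      sin_le_sin_of_le_of_le_pi_div_two (by linarith) hb' (by linarith)
    have h2 : 0 ≤ sin (c - a) := sin_nonneg_of_nonneg_of_le_pi (by linarith) (by linarith)
    have h3 : sin c = sin a * cos (c - a) + cos a * sin (c - a) := by
      rw [← sin_add]; congr 1; ring
    rw [h3]
    nlinarith [cos_le_one a, cos_le_one (c - a)]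

/-- By concavity, the slope `sin x / x` decreases. -/
theorem mul_sin_le_mul_sin {a b : ℝ} (ha : 0 ≤ a) (hab : a ≤ b) (hb : b ≤ π) :
    a * sin b ≤ b * sin a := by
  rcases hab.eq_or_lt with rfl | hab'
  · rfl
  have hb0 : 0 < b := ha.trans_lt hab'
  have h0 : 0 ≤ 1 - a / b := by rw [sub_nonneg, div_le_one hb0]; exact hab
  have h1 : 0 ≤ a / b := by positivity
  have h := strictConcaveOn_sin_Icc.concaveOn.2 (left_mem_Icc.2 pi_pos.le)
    (⟨hb0.le, hb⟩ : b ∈ Icc 0 π) h0 h1 (by ring)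
  simp only [smul_eq_mul, mul_zero, sin_zero, zero_add] at h
  rw [div_mul_cancel₀ _ hb0.ne', div_mul_eq_mul_div, div_le_iff₀ hb0] at h
  linarith

theorem le_one_add_mul_sin {x η : ℝ} (hx : 0 ≤ x) (hxη : x ≤ η) (hη : η ≤ 1) :
    x ≤ (1 + η) * sin x := by
  rcases hx.eq_or_lt with rfl | hx
  · simp
  have h := sin_gt_sub_cube hx
  have h1 : 0 ≤ η := by linarith
  have h2 : x ≤ (1 + η) * (x - x ^ 3 / 6) := by
    have : x ^ 2 ≤ η := by nlinarith
    have : (1 + η) * x ^ 2 ≤ 6 * η := by nlinarith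
    nlinarith
  exact h2.trans (mul_le_mul_of_nonneg_left h.le (by linarith))

/-- The law of cosines reads `‖p - q‖² = (‖p‖ - ‖q‖)² + 4 ‖p‖ ‖q‖ sin² (ψ / 2)`, so projecting
radially onto the circle cannot increase the distance. -/
theorem two_mul_sin_angle_le_norm_sub {p q : ℂ} {R : ℝ} (hR : 0 ≤ R) (hp : R ≤ ‖p‖)
    (hq : R ≤ ‖q‖) : 2 * R * sin (InnerProductGeometry.angle p q / 2) ≤ ‖p - q‖ := by
  set ψ := InnerProductGeometry.angle p q with hψ
  have h := InnerProductGeometry.norm_sub_sq_eq_norm_sq_add_norm_sq_sub_two_mul_norm_mul_norm_mul_cos_angle p q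
  have hc : cos ψ = 1 - 2 * sin (ψ / 2) ^ 2 := by
    have := cos_two_mul (ψ / 2)
    rw [mul_div_cancel₀ _ two_ne_zero] at this
    linarith [sin_sq_add_cos_sq (ψ / 2)]
  rw [← hψ, hc] at h
  refine abs_le_of_sq_le_sq' ?_ (norm_nonneg _) |>.2
  have h1 : R * R ≤ ‖p‖ * ‖q‖ := mul_le_mul hp hq hR (norm_nonneg _)
  nlinarith [sq_nonneg (‖p‖ - ‖q‖), mul_le_mul_of_nonneg_right h1 (sq_nonneg (sin (ψ / 2)))]

theorem norm_sub_eq_two_mul_sin_angle {p q : ℂ} {R : ℝ} (hp : ‖p‖ = R)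
    (hq : ‖q‖ = R) : ‖p - q‖ = 2 * R * sin (InnerProductGeometry.angle p q / 2) := by
  have hR : 0 ≤ R := hp ▸ norm_nonneg p
  refine le_antisymm ?_ (two_mul_sin_angle_le_norm_sub hR hp.ge hq.ge)
  set ψ := InnerProductGeometry.angle p q with hψ
  have h := InnerProductGeometry.norm_sub_sq_eq_norm_sq_add_norm_sq_sub_two_mul_norm_mul_norm_mul_cos_angle p q
  have hc : cos ψ = 1 - 2 * sin (ψ / 2) ^ 2 := by
    have := cos_two_mul (ψ / 2)
    rw [mul_div_cancel₀ _ two_ne_zero] at this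
    linarith [sin_sq_add_cos_sq (ψ / 2)]
  rw [← hψ, hc, hp, hq] at h
  have hs : 0 ≤ sin (ψ / 2) := sin_nonneg_of_nonneg_of_le_pi
    (by linarith [InnerProductGeometry.angle_nonneg p q])
    (by linarith [InnerProductGeometry.angle_le_pi p q, pi_pos])
  refine abs_le_of_sq_le_sq' ?_ (by positivity) |>.2
  nlinarith

namespace RectifiablePath

theorem exists_dist_extend_le {x y : ℂ} (γ : RectifiablePath x y) {D : ℝ} (hD : 0 < D) :
    ∃ δ > 0, ∀ a b : ℝ, |a - b| ≤ δ → dist (γ.toPath.extend a) (γ.toPath.extend b) < D := by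
  have hu : UniformContinuous γ.toPath.extend :=
    (CompactSpace.uniformContinuous_of_continuous γ.toPath.continuous).comp
      (LipschitzWith.projIcc zero_le_one).uniformContinuous
  obtain ⟨δ, hδ, h⟩ := Metric.uniformContinuous_iff.1 hu D hD
  exact ⟨δ / 2, by positivity, fun a b hab ↦ h (by rw [Real.dist_eq]; linarith)⟩

end RectifiablePath

namespace WeightedDisks

variable {n : ℕ} (S : WeightedDisks n) {x y : ℂ}

/-- The angle at the center of the `i`-th disk between two points. -/
noncomputable def centralAngle (i : Fin n) (u v : ℂ) : ℝ :=
  InnerProductGeometry.angle (u - S.center i) (v - S.center i)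

/-- The lesser of the weighted lengths of the chord and of the arc of central angle `ψ`. -/
noncomputable def crossing (i : Fin n) (ψ : ℝ) : ℝ :=
  min (S.weight i * (2 * S.radius i * sin (ψ / 2))) (min 1 (S.weight i) * (S.radius i * ψ))

theorem centralAngle_nonneg (i : Fin n) (u v : ℂ) : 0 ≤ S.centralAngle i u v :=
  InnerProductGeometry.angle_nonneg _ _

theorem centralAngle_le_pi (i : Fin n) (u v : ℂ) : S.centralAngle i u v ≤ π :=
  InnerProductGeometry.angle_le_pi _ _

theorem centralAngle_comm (i : Fin n) (u v : ℂ) : S.centralAngle i u v = S.centralAngle i v u :=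
  InnerProductGeometry.angle_comm _ _

theorem centralAngle_triangle (i : Fin n) (u v w : ℂ) :
    S.centralAngle i u w ≤ S.centralAngle i u v + S.centralAngle i v w :=
  InnerProductGeometry.angle_le_angle_add_angle _ _ _

theorem two_mul_sin_centralAngle_le_dist (i : Fin n) {u v : ℂ}
    (hu : S.radius i ≤ dist u (S.center i)) (hv : S.radius i ≤ dist v (S.center i)) :
    2 * S.radius i * sin (S.centralAngle i u v / 2) ≤ dist u v := by
  rw [dist_eq_norm] at hu hv
  have := two_mul_sin_angle_le_norm_sub (S.radius_pos i).le hu hv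
  rwa [sub_sub_sub_cancel_right, ← dist_eq_norm] at this

theorem dist_eq_two_mul_sin_centralAngle (i : Fin n) {u v : ℂ}
    (hu : u ∈ Metric.sphere (S.center i) (S.radius i))
    (hv : v ∈ Metric.sphere (S.center i) (S.radius i)) :
    dist u v = 2 * S.radius i * sin (S.centralAngle i u v / 2) := by
  rw [mem_sphere_iff_norm] at hu hv
  have := norm_sub_eq_two_mul_sin_angle hu hv
  rwa [sub_sub_sub_cancel_right, ← dist_eq_norm] at this

/-- Two arcs add up to an arc and two chords dominate a chord. The delicate case is an arc followed
by a chord, treated in `mixed`. -/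
theorem crossing_le_add (i : Fin n) {ψ₁ ψ₂ ψ₃ : ℝ} (h₁ : 0 ≤ ψ₁) (h₂ : 0 ≤ ψ₂) (h₃ : 0 ≤ ψ₃)
    (h₁' : ψ₁ ≤ π) (h₂' : ψ₂ ≤ π) (h₃' : ψ₃ ≤ π) (h : ψ₃ ≤ ψ₁ + ψ₂) :
    S.crossing i ψ₃ ≤ S.crossing i ψ₁ + S.crossing i ψ₂ := by
  have hR := S.radius_pos i
  have hω := S.weight_nonneg i
  have hm : 0 ≤ min 1 (S.weight i) := le_min zero_le_one hω
  set m := min 1 (S.weight i) with hm_def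
  set R := S.radius i with hR_def
  set ω := S.weight i with hω_def
  -- Where the chord of `φ₂` is no dearer than its arc, its cost per angle is at most `m * R`. By
  -- concavity, lengthening that chord to `ψ₃` adds at most this rate, so a single chord does as
  -- well as arc plus chord.
  have mixed : ∀ φ₁ φ₂ : ℝ, 0 ≤ φ₁ → 0 ≤ φ₂ → φ₂ ≤ π → ψ₃ ≤ φ₁ + φ₂ →
      ω * (2 * R * sin (φ₂ / 2)) ≤ m * (R * φ₂) →
      min (ω * (2 * R * sin (ψ₃ / 2))) (m * (R * ψ₃)) ≤
        m * (R * φ₁) + ω * (2 * R * sin (φ₂ / 2)) := by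
    intro φ₁ φ₂ hφ₁ hφ₂ hφ₂' hle hch
    rcases le_total ψ₃ φ₂ with h' | h'
    · refine (min_le_left _ _).trans ?_
      have h1 : sin (ψ₃ / 2) ≤ sin (φ₂ / 2) :=
        sin_le_sin_of_le_of_le_pi_div_two (by linarith [pi_pos]) (by linarith) (by linarith)
      have h2 : ω * (2 * R * sin (ψ₃ / 2)) ≤ ω * (2 * R * sin (φ₂ / 2)) := by gcongr
      have h3 : 0 ≤ m * (R * φ₁) := by positivity
      linarith
    · rcases hφ₂.eq_or_lt with rfl | hφ₂
      · refine (min_le_right _ _).trans ?_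
        simp only [zero_div, sin_zero, mul_zero, add_zero] at hle ⊢
        gcongr
      · have h1 := mul_sin_le_mul_sin (a := φ₂ / 2) (b := ψ₃ / 2) (by linarith) (by linarith)
          (by linarith [pi_pos])
        have h2 : 2 * ω * R * (φ₂ * sin (ψ₃ / 2)) ≤ 2 * ω * R * (ψ₃ * sin (φ₂ / 2)) :=
          mul_le_mul_of_nonneg_left (by linarith) (by positivity)
        have h3 : (ψ₃ - φ₂) * (ω * (2 * R * sin (φ₂ / 2))) ≤ (ψ₃ - φ₂) * (m * (R * φ₂)) :=
          mul_le_mul_of_nonneg_left hch (by linarith)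
        have h4 : φ₂ * (m * R * (ψ₃ - φ₂)) ≤ φ₂ * (m * R * φ₁) := by
          gcongr; linarith
        refine (min_le_left _ _).trans ?_
        refine le_of_mul_le_mul_left ?_ hφ₂
        nlinarith
  have arcs : m * (R * ψ₃) ≤ m * (R * ψ₁) + m * (R * ψ₂) := by
    rw [← mul_add, ← mul_add]; gcongr
  have chords : ω * (2 * R * sin (ψ₃ / 2)) ≤
      ω * (2 * R * sin (ψ₁ / 2)) + ω * (2 * R * sin (ψ₂ / 2)) := by
    rw [← mul_add, ← mul_add]
    gcongr
    exact sin_le_sin_add_sin_of_le_add (by linarith) (by linarith) (by linarith) (by linarith)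
      (by linarith) (by linarith)
  simp only [crossing, ← hm_def, ← hR_def, ← hω_def]
  rcases min_cases (ω * (2 * R * sin (ψ₁ / 2))) (m * (R * ψ₁)) with ⟨e₁, l₁⟩ | ⟨e₁, l₁⟩ <;>
  rcases min_cases (ω * (2 * R * sin (ψ₂ / 2))) (m * (R * ψ₂)) with ⟨e₂, l₂⟩ | ⟨e₂, l₂⟩ <;>
  rw [e₁, e₂]
  · exact (min_le_left _ _).trans chords
  · rw [add_comm]
    exact mixed ψ₂ ψ₁ h₂ h₁ h₁' (by linarith) l₁
  · exact mixed ψ₁ ψ₂ h₁ h₂ h₂' h l₂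
  · exact (min_le_right _ _).trans arcs

end WeightedDisks

end

/-! ### Lower bound for a portion that meets only one disk -/

section

open MeasureTheory Set Filter Topology

namespace WeightedDisks

variable {n : ℕ} (S : WeightedDisks n) {x y : ℂ} (γ : RectifiablePath x y)

theorem weightedMeasure_Ioc_add {a b c : ℝ} (hab : a ≤ b) (hbc : b ≤ c) :
    S.weightedMeasure γ (Ioc a b) + S.weightedMeasure γ (Ioc b c) =
      S.weightedMeasure γ (Ioc a c) := by
  rw [← Ioc_union_Ioc_eq_Ioc hab hbc, measure_union (Ioc_disjoint_Ioc_of_le le_rfl)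
    measurableSet_Ioc]

theorem crossing_le_chord (i : Fin n) {u v : ℂ} (hu : S.radius i ≤ dist u (S.center i))
    (hv : S.radius i ≤ dist v (S.center i)) :
    S.crossing i (S.centralAngle i u v) ≤ S.weight i * dist u v := by
  refine (min_le_left _ _).trans ?_
  exact mul_le_mul_of_nonneg_left (S.two_mul_sin_centralAngle_le_dist i hu hv)
    (S.weight_nonneg i)

theorem crossing_nonneg (i : Fin n) {ψ : ℝ} (h : 0 ≤ ψ) (h' : ψ ≤ π) : 0 ≤ S.crossing i ψ := by
  have hR := S.radius_pos i
  have hω := S.weight_nonneg i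
  have hs : 0 ≤ sin (ψ / 2) := sin_nonneg_of_nonneg_of_le_pi (by linarith) (by linarith)
  exact le_min (by positivity) (mul_nonneg (le_min zero_le_one hω) (by positivity))

/-- Jordan's inequality turns the bound on the distance into `ψ / 2 ≤ η`; at such angles arc and
chord differ by a factor of at most `1 + η`. -/
theorem crossing_le_of_dist_le (i : Fin n) {u v : ℂ} {η : ℝ} (hη : η ≤ 1) (hη0 : 0 ≤ η)
    (hu : S.radius i ≤ dist u (S.center i)) (hv : S.radius i ≤ dist v (S.center i))
    (h : dist u v ≤ 4 * S.radius i / π * η) :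
    S.crossing i (S.centralAngle i u v) ≤ (1 + η) * (min 1 (S.weight i) * dist u v) := by
  have hR := S.radius_pos i
  have hm : 0 ≤ min 1 (S.weight i) := le_min zero_le_one (S.weight_nonneg i)
  have h1 := S.two_mul_sin_centralAngle_le_dist i hu hv
  have h0 := S.centralAngle_nonneg i u v
  have hpi := S.centralAngle_le_pi i u v
  set ψ := S.centralAngle i u v
  have h2 := mul_le_sin (x := ψ / 2) (by linarith) (by linarith)
  have h3 : ψ / 2 ≤ η := by
    have : 2 * S.radius i * (2 / π * (ψ / 2)) ≤ 4 * S.radius i / π * η :=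
      (mul_le_mul_of_nonneg_left h2 (by positivity)).trans (h1.trans h)
    have h4 : 4 * S.radius i / π * (ψ / 2) ≤ 4 * S.radius i / π * η := by
      calc _ = 2 * S.radius i * (2 / π * (ψ / 2)) := by ring
        _ ≤ _ := this
    exact le_of_mul_le_mul_left h4 (by positivity)
  have h4 := le_one_add_mul_sin (by linarith) h3 hη
  refine (min_le_right _ _).trans ?_
  calc min 1 (S.weight i) * (S.radius i * ψ)
      = min 1 (S.weight i) * (2 * S.radius i * (ψ / 2)) := by ring
    _ ≤ min 1 (S.weight i) * (2 * S.radius i * ((1 + η) * sin (ψ / 2))) := by gcongr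
    _ = (1 + η) * (min 1 (S.weight i) * (2 * S.radius i * sin (ψ / 2))) := by ring
    _ ≤ _ := by gcongr

theorem ofReal_mul_dist_le {w : ℝ} (hw : 0 ≤ w) {a b : ℝ} (hab : a ≤ b)
    (h : ENNReal.ofReal w * γ.arcLength (Ioo a b) ≤ S.weightedMeasure γ (Ioo a b)) :
    ENNReal.ofReal (w * dist (γ.toPath.extend a) (γ.toPath.extend b)) ≤
      S.weightedMeasure γ (Ioc a b) := by
  rw [ENNReal.ofReal_mul hw, ← edist_dist]
  refine (mul_le_mul_right (γ.edist_le_arcLength_Ioo hab) _).trans (h.trans ?_)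
  exact measure_mono Ioo_subset_Ioc_self

/-- Induction on the number of time steps `δ`. Each step splits off a short piece, whose arc is
controlled up to `1 + η`, and a possible excursion into the open disk, controlled by its chord;
subadditivity joins them to the rest. -/
theorem crossing_le_one_add_mul (i : Fin n) {η : ℝ} (hη : η ≤ 1) (hη0 : 0 < η) {b : ℝ}
    (hb : S.radius i ≤ dist (γ.toPath.extend b) (S.center i)) {δ : ℝ} (hδ : 0 < δ)
    (hclose : ∀ s t : ℝ, |s - t| ≤ δ →
      dist (γ.toPath.extend s) (γ.toPath.extend t) < 4 * S.radius i / π * η) (N : ℕ) :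
    ∀ a ≤ b, b - a ≤ N * δ → S.radius i ≤ dist (γ.toPath.extend a) (S.center i) →
    (∀ τ ∈ Icc a b, ∀ j ≠ i, γ.toPath.extend τ ∉ Metric.closedBall (S.center j) (S.radius j)) →
    ENNReal.ofReal (S.crossing i (S.centralAngle i (γ.toPath.extend a) (γ.toPath.extend b))) ≤
      ENNReal.ofReal (1 + η) * S.weightedMeasure γ (Ioc a b) := by
  have hm : 0 ≤ min 1 (S.weight i) := le_min zero_le_one (S.weight_nonneg i)
  have short : ∀ s t : ℝ, s ≤ t → t - s ≤ δ →
      S.radius i ≤ dist (γ.toPath.extend s) (S.center i) →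
      S.radius i ≤ dist (γ.toPath.extend t) (S.center i) →
      (∀ τ ∈ Ioo s t, ∀ j ≠ i, γ.toPath.extend τ ∉ Metric.closedBall (S.center j) (S.radius j)) →
      ENNReal.ofReal (S.crossing i (S.centralAngle i (γ.toPath.extend s) (γ.toPath.extend t))) ≤
        ENNReal.ofReal (1 + η) * S.weightedMeasure γ (Ioc s t) := by
    intro s t hst hd hs ht hno
    have h1 := S.crossing_le_of_dist_le i hη hη0.le hs ht
      (hclose s t (by rw [abs_sub_comm, abs_of_nonneg (by linarith)]; exact hd)).le
    refine (ENNReal.ofReal_le_ofReal h1).trans ?_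
    rw [ENNReal.ofReal_mul (by linarith)]
    gcongr
    exact S.ofReal_mul_dist_le γ hm hst (S.min_weight_mul_arcLength_le γ measurableSet_Ioo i hno)
  induction N with
  | zero =>
    intro a hab hN ha hno
    have : a = b := by simp at hN; linarith
    subst this
    exact short a a le_rfl (by linarith) ha ha (by simp)
  | succ N ih =>
    intro a hab hN ha hno
    by_cases hsmall : b - a ≤ δ
    · exact short a b hab hsmall ha hb fun τ hτ ↦ hno τ (Ioo_subset_Icc_self hτ)
    have hclosed : IsClosed {τ | S.radius i ≤ dist (γ.toPath.extend τ) (S.center i)} :=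
      isClosed_le continuous_const (γ.continuous_extend.dist continuous_const)
    -- `p` and `q` are the last time before and the first time after `a + δ` at which the path is
    -- not in the open disk. They coincide if it is not there at `a + δ`; in any case `q ≥ a + δ`,
    -- which uses up one step.
    obtain ⟨p, ⟨hp, hpE⟩, hpmax⟩ := (isCompact_Icc.inter_right hclosed).exists_isGreatest
      (⟨a, ⟨le_rfl, by linarith⟩, ha⟩ : (Icc a (a + δ) ∩
        {τ | S.radius i ≤ dist (γ.toPath.extend τ) (S.center i)}).Nonempty)
    obtain ⟨q, ⟨hq, hqE⟩, hqmin⟩ := (isCompact_Icc.inter_right hclosed).exists_isLeast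
      (⟨b, ⟨by linarith, le_rfl⟩, hb⟩ : (Icc (a + δ) b ∩
        {τ | S.radius i ≤ dist (γ.toPath.extend τ) (S.center i)}).Nonempty)
    have hpq : p ≤ q := hp.2.trans hq.1
    have hball : ∀ τ ∈ Ioo p q,
        γ.toPath.extend τ ∈ Metric.ball (S.center i) (S.radius i) := by
      intro τ hτ
      by_contra hcon
      rw [Metric.mem_ball, not_lt] at hcon
      rcases le_total τ (a + δ) with h | h
      · exact absurd (hpmax ⟨⟨hp.1.trans hτ.1.le, h⟩, hcon⟩) (not_le.2 hτ.1)
      · exact absurd (hqmin ⟨⟨h, hτ.2.le.trans hq.2⟩, hcon⟩) (not_le.2 hτ.2)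
    have h1 := short a p hp.1 (by linarith [hp.2]) ha hpE
      fun τ hτ ↦ hno τ ⟨hτ.1.le, by linarith [hτ.2, hpq, hq.2]⟩
    have h2 : ENNReal.ofReal
        (S.crossing i (S.centralAngle i (γ.toPath.extend p) (γ.toPath.extend q))) ≤
        ENNReal.ofReal (1 + η) * S.weightedMeasure γ (Ioc p q) := by
      refine (ENNReal.ofReal_le_ofReal (S.crossing_le_chord i hpE hqE)).trans ?_
      refine (S.ofReal_mul_dist_le γ (S.weight_nonneg i) hpq
        (S.weight_mul_arcLength_le γ measurableSet_Ioo i hball)).trans ?_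
      refine le_mul_of_one_le_left' ?_
      rw [ENNReal.one_le_ofReal]
      linarith
    have h3 := ih q hq.2 (by push_cast at hN; linarith [hq.1]) hqE
      fun τ hτ ↦ hno τ ⟨by linarith [hτ.1, hp.1], hτ.2⟩
    have tri1 := S.crossing_le_add i (S.centralAngle_nonneg i _ _) (S.centralAngle_nonneg i _ _)
      (S.centralAngle_nonneg i _ _) (S.centralAngle_le_pi i _ _) (S.centralAngle_le_pi i _ _)
      (S.centralAngle_le_pi i _ _) (S.centralAngle_triangle i (γ.toPath.extend a)
        (γ.toPath.extend p) (γ.toPath.extend b))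
    have tri2 := S.crossing_le_add i (S.centralAngle_nonneg i _ _) (S.centralAngle_nonneg i _ _)
      (S.centralAngle_nonneg i _ _) (S.centralAngle_le_pi i _ _) (S.centralAngle_le_pi i _ _)
      (S.centralAngle_le_pi i _ _) (S.centralAngle_triangle i (γ.toPath.extend p)
        (γ.toPath.extend q) (γ.toPath.extend b))
    rw [← S.weightedMeasure_Ioc_add γ hp.1 (hpq.trans hq.2),
      ← S.weightedMeasure_Ioc_add γ hpq hq.2, mul_add, mul_add]
    refine le_trans ?_ (add_le_add h1 (add_le_add h2 h3))
    refine (ENNReal.ofReal_le_ofReal (tri1.trans (add_le_add_right tri2 _))).trans ?_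
    refine ENNReal.ofReal_add_le.trans (add_le_add_right ENNReal.ofReal_add_le _)

/-- A portion of a path between two points of the `i`-th circle that touches no other disk is at
least as long as the shorter of the chord and the arc. -/
theorem crossing_le_weightedMeasure (i : Fin n) {a b : ℝ} (hab : a ≤ b)
    (ha : S.radius i ≤ dist (γ.toPath.extend a) (S.center i))
    (hb : S.radius i ≤ dist (γ.toPath.extend b) (S.center i))
    (hno : ∀ τ ∈ Icc a b, ∀ j ≠ i,
      γ.toPath.extend τ ∉ Metric.closedBall (S.center j) (S.radius j)) :
    ENNReal.ofReal (S.crossing i (S.centralAngle i (γ.toPath.extend a) (γ.toPath.extend b))) ≤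
      S.weightedMeasure γ (Ioc a b) := by
  have key : ∀ η : ℝ, η ∈ Ioo (0 : ℝ) 1 →
      ENNReal.ofReal (S.crossing i (S.centralAngle i (γ.toPath.extend a) (γ.toPath.extend b))) ≤
      ENNReal.ofReal (1 + η) * S.weightedMeasure γ (Ioc a b) := by
    intro η hη
    have hR := S.radius_pos i
    have hη0 := hη.1
    obtain ⟨δ, hδ, hclose⟩ := γ.exists_dist_extend_le (D := 4 * S.radius i / π * η) (by positivity)
    obtain ⟨N, hN⟩ := exists_nat_ge ((b - a) / δ)
    exact S.crossing_le_one_add_mul γ i hη.2.le hη.1 hb hδ hclose N a hab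
      ((div_le_iff₀ hδ).1 hN) ha hno
  have hlim : Tendsto (fun η : ℝ ↦ ENNReal.ofReal (1 + η) * S.weightedMeasure γ (Ioc a b))
      (𝓝[>] 0) (𝓝 (ENNReal.ofReal (1 + 0) * S.weightedMeasure γ (Ioc a b))) := by
    refine ENNReal.Tendsto.mul_const ?_ (Or.inl (by simp))
    exact (ENNReal.continuous_ofReal.comp (continuous_const.add continuous_id)).continuousAt.tendsto.mono_left
      nhdsWithin_le_nhds
  rw [add_zero, ENNReal.ofReal_one, one_mul] at hlim
  refine ge_of_tendsto hlim ?_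
  filter_upwards [Ioo_mem_nhdsGT (zero_lt_one' ℝ)] with η hη using key η hη

end WeightedDisks

end

/-! ### Gaps, constants and the cost of moving a point to a node -/

section

open Set Filter Topology

namespace WeightedDisks

variable {n : ℕ} (S : WeightedDisks n)

theorem radius_add_radius_lt_dist {i j : Fin n} (h : i ≠ j) :
    S.radius i + S.radius j < dist (S.center i) (S.center j) :=
  (disjoint_closedBall_closedBall_iff (S.radius_pos i).le (S.radius_pos j).le).1
    (S.disjoint i j h)

theorem gap_le_dist {i j : Fin n} (h : i ≠ j) {u v : ℂ}
    (hu : u ∈ Metric.closedBall (S.center i) (S.radius i))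
    (hv : v ∈ Metric.closedBall (S.center j) (S.radius j)) : S.gap i ≤ dist u v := by
  have h1 : S.gap i ≤ dist (S.center i) (S.center j) - S.radius i - S.radius j :=
    ciInf_le (Finite.bddBelow_range _) (⟨j, h.symm⟩ : {j : Fin n // j ≠ i})
  rw [Metric.mem_closedBall] at hu hv
  have h2 := dist_triangle4 (S.center i) u v (S.center j)
  rw [dist_comm (S.center i) u] at h2
  linarith

variable (hn : 2 ≤ n)
include hn

theorem gap_pos (i : Fin n) : 0 < S.gap i := by
  have : Nontrivial (Fin n) := Fin.nontrivial_iff_two_le.2 hn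
  obtain ⟨j, hj⟩ := exists_ne i
  have : Nonempty {j : Fin n // j ≠ i} := ⟨⟨j, hj⟩⟩
  obtain ⟨k, hk⟩ := exists_eq_ciInf_of_finite
    (f := fun j : {j : Fin n // j ≠ i} ↦ dist (S.center i) (S.center j) - S.radius i - S.radius j)
  rw [gap, ← hk]
  linarith [S.radius_add_radius_lt_dist k.2.symm]

theorem le_cConst (i : Fin n) : π / 2 * S.radius i / S.gap i ≤ S.cConst := by
  have : Nonempty (Fin n) := ⟨i⟩
  obtain ⟨k, hk⟩ := exists_eq_ciInf_of_finite (f := S.gap)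
  have h1 : 0 < ⨅ i, S.gap i := hk ▸ S.gap_pos hn k
  have h2 : ⨅ i, S.gap i ≤ S.gap i := ciInf_le (Finite.bddBelow_range _) i
  have h3 : S.radius i ≤ ⨆ i, S.radius i := le_ciSup (Finite.bddAbove_range _) i
  have h4 : 0 < ⨆ i, S.radius i := (S.radius_pos i).trans_le h3
  rw [cConst]
  gcongr

/-- The square root is at least `1 + 3 c`. This lower bound is the only quantitative information on
`a` needed later. -/
theorem one_add_le_aConst (i : Fin n) : 1 + 3 * (π / 2 * S.radius i / S.gap i) ≤ S.aConst := by
  have h := S.le_cConst hn i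
  have h0 : 0 ≤ π / 2 * S.radius i / S.gap i := by
    have := S.radius_pos i
    have := S.gap_pos hn i
    positivity
  have h1 : 1 + 3 * S.cConst ≤ √(9 * S.cConst ^ 2 + 10 * S.cConst + 1) := by
    apply Real.le_sqrt_of_sq_le
    nlinarith
  rw [aConst]
  linarith

theorem one_le_aConst : 1 ≤ S.aConst := by
  have i : Fin n := ⟨0, by omega⟩
  refine le_trans ?_ (S.one_add_le_aConst hn i)
  have := S.radius_pos i
  have := S.gap_pos hn i
  have : 0 ≤ 3 * (π / 2 * S.radius i / S.gap i) := by positivity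
  linarith

theorem le_aConst_mul_gap (i : Fin n) :
    S.gap i + 3 * π / 2 * S.radius i ≤ S.aConst * S.gap i := by
  have h := mul_le_mul_of_nonneg_right (S.one_add_le_aConst hn i) (S.gap_pos hn i).le
  refine le_trans (le_of_eq ?_) h
  have := (S.gap_pos hn i).ne'
  field_simp

/-- The sine of the weighted angular radius. -/
noncomputable def angularSine (i : Fin n) : ℝ :=
  min (S.gap i) (S.radius i) * min 1 (S.weight i) / (4 * S.radius i * max 1 (S.weight i))

omit hn in
theorem angularSine_le (i : Fin n) : S.angularSine i ≤ 1 / 4 := by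
  have hR := S.radius_pos i
  have hω := S.weight_nonneg i
  have hM : (1 : ℝ) ≤ max 1 (S.weight i) := le_max_left _ _
  rw [angularSine, div_le_div_iff₀ (by positivity) (by norm_num)]
  have h1 : min (S.gap i) (S.radius i) * min 1 (S.weight i) ≤ S.radius i * max 1 (S.weight i) :=
    mul_le_mul (min_le_right _ _) ((min_le_left _ _).trans hM) (le_min zero_le_one hω) hR.le
  linarith

theorem angularSine_pos {i : Fin n} (hi : 0 < S.weight i) : 0 < S.angularSine i := by
  have hR := S.radius_pos i
  have hg := S.gap_pos hn i
  have h1 : 0 < min (S.gap i) (S.radius i) := lt_min hg hR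
  have h2 : 0 < min 1 (S.weight i) := lt_min one_pos hi
  rw [angularSine]
  positivity

theorem angularRadius_pos {i : Fin n} (hi : 0 < S.weight i) : 0 < S.angularRadius i :=
  arcsin_pos.2 (S.angularSine_pos hn hi)

/-- A sine of at most `1 / 4` forces `α ≤ π / 8 < 0.4`, and there `sin α > α - α³ / 6` gives `1 / (1
- 0.16 / 6) < 1.03`. -/
theorem angularRadius_le {i : Fin n} (hi : 0 < S.weight i) :
    S.angularRadius i ≤ 1.03 * S.angularSine i := by
  have h0 := S.angularSine_pos hn hi
  have h1 := S.angularSine_le i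
  have hα := S.angularRadius_pos hn hi
  have hs : sin (S.angularRadius i) = S.angularSine i :=
    sin_arcsin (x := S.angularSine i) (by linarith) (by linarith)
  have hα' : S.angularRadius i ≤ π / 2 := arcsin_le_pi_div_two _
  have h2 := mul_le_sin hα.le hα'
  have h3 := sin_gt_sub_cube hα
  rw [hs] at h2 h3
  have hpi := pi_lt_d2
  have h4 : S.angularRadius i ≤ 0.4 := by
    have : S.angularRadius i * 2 ≤ S.angularSine i * π := by
      rw [div_mul_eq_mul_div, div_le_iff₀ pi_pos] at h2
      linarith
    nlinarith [pi_pos]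
  nlinarith [mul_pos hα hα, mul_nonneg hα.le (mul_nonneg (sub_nonneg.2 h4) (add_pos hα (by norm_num : (0:ℝ) < 0.4)).le)]

/-- From `π < 2 α (k + 1)` and the previous bound, `k sin α ≥ 3.14 / 2.06 - 1 / 4 > 5 / 4`; the loss
by the floor is at most `sin α ≤ 1 / 4`. -/
theorem le_angularSine_mul_numCenters {i : Fin n} (hi : 0 < S.weight i) :
    5 / 4 ≤ S.angularSine i * S.numCenters i := by
  have h0 := S.angularSine_pos hn hi
  have h1 := S.angularSine_le i
  have hα := S.angularRadius_pos hn hi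
  have h2 := S.angularRadius_le hn hi
  have h3 : π / (2 * S.angularRadius i) < S.numCenters i + 1 := Nat.lt_floor_add_one _
  rw [div_lt_iff₀ (by positivity)] at h3
  have hpi := pi_gt_d2
  have hk : (0 : ℝ) ≤ S.numCenters i := Nat.cast_nonneg _
  nlinarith

theorem five_le_numCenters {i : Fin n} (hi : 0 < S.weight i) : (5 : ℝ) ≤ S.numCenters i := by
  have h := S.le_angularSine_mul_numCenters hn hi
  have h1 := S.angularSine_le i
  have hk : (0 : ℝ) ≤ S.numCenters i := Nat.cast_nonneg _
  nlinarith

theorem two_mul_angularRadius_le {i : Fin n} (hi : 0 < S.weight i) :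
    2 * S.angularRadius i ≤ π / S.numCenters i := by
  have hα := S.angularRadius_pos hn hi
  have hk := S.five_le_numCenters hn hi
  have h : (S.numCenters i : ℝ) ≤ π / (2 * S.angularRadius i) := Nat.floor_le (by positivity)
  rw [le_div_iff₀ (by positivity)] at h
  rw [le_div_iff₀ (by linarith)]
  linarith

omit hn

open Classical in
/-- A central angle within which every point of the `i`-th circle has a Steiner point. -/
noncomputable def snapAngle (ε : ℝ) (i : Fin n) : ℝ :=
  if S.weight i = 0 then S.zeroStep ε i
  else 2 * S.weight i * ε / (S.aConst * π) * (2 * π / S.numCenters i)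

include hn

variable {ε : ℝ} (hε : 0 < ε)
include hε

theorem zeroStep_pos (i : Fin n) : 0 < S.zeroStep ε i := by
  have h1 := S.gap_pos hn i
  have h2 := S.one_le_aConst hn
  rw [zeroStep]
  positivity

theorem snapAngle_nonneg (i : Fin n) : 0 ≤ S.snapAngle ε i := by
  have h2 := S.one_le_aConst hn
  have h3 := S.weight_nonneg i
  rw [snapAngle]
  split_ifs
  · exact (S.zeroStep_pos hn hε i).le
  · positivity

/-- The left side is `4 R ω ε / k`. The choice of `α` gives `4 R ω sin α ≤ min d R`, and `k sin α ≥
5 / 4` yields the factor `0.8`. -/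
theorem radius_mul_snapAngle_le_of_pos {i : Fin n} (hi : 0 < S.weight i) :
    S.aConst * (S.radius i * S.snapAngle ε i) ≤ 0.8 * (ε * min (S.gap i) (S.radius i)) := by
  have ha := S.one_le_aConst hn
  have hk := S.le_angularSine_mul_numCenters hn hi
  have hk5 := S.five_le_numCenters hn hi
  have hR := S.radius_pos i
  have hg := S.gap_pos hn i
  have hd : 0 < min (S.gap i) (S.radius i) := lt_min hg hR
  rw [snapAngle, if_neg hi.ne']
  have e1 : S.aConst * (S.radius i * (2 * S.weight i * ε / (S.aConst * π) *
      (2 * π / S.numCenters i))) = 4 * S.radius i * S.weight i * ε / S.numCenters i := by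
    have := pi_pos
    field_simp
    ring
  rw [e1, div_le_iff₀ (by linarith)]
  have h1 : 4 * S.radius i * S.weight i * S.angularSine i ≤ min (S.gap i) (S.radius i) := by
    have hM : (1 : ℝ) ≤ max 1 (S.weight i) := le_max_left _ _
    have : S.weight i * min 1 (S.weight i) ≤ max 1 (S.weight i) := by
      rcases le_total (S.weight i) 1 with h | h
      · rw [min_eq_right h, max_eq_left h]; nlinarith
      · rw [min_eq_left h, max_eq_right h]; linarith
    have e2 : 4 * S.radius i * S.weight i * S.angularSine i = min (S.gap i) (S.radius i) *
        (S.weight i * min 1 (S.weight i) / max 1 (S.weight i)) := by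
      rw [angularSine]
      field_simp
    rw [e2]
    exact mul_le_of_le_one_right hd.le ((div_le_one (by linarith)).2 this)
  have h2 : 4 * S.radius i * S.weight i * ε * (5 / 4) ≤
      4 * S.radius i * S.weight i * ε * (S.angularSine i * S.numCenters i) := by gcongr
  have h3 : 4 * S.radius i * S.weight i * S.angularSine i * (ε * S.numCenters i) ≤
      min (S.gap i) (S.radius i) * (ε * S.numCenters i) := by gcongr
  nlinarith

/-- The cost of moving an endpoint of an edge to a Steiner point. -/
theorem snap_cost_le (hweight : ∀ i, S.weight i ≤ π / 2) (i : Fin n) :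
    (1 + π / 2 * S.weight i) * (S.radius i * S.snapAngle ε i) ≤ ε * S.gap i / 2 := by
  have ha := S.one_le_aConst hn
  have hag := S.le_aConst_mul_gap hn i
  have hR := S.radius_pos i
  have hg := S.gap_pos hn i
  have hpi := pi_gt_d2
  have hpi' := pi_lt_d2
  rcases (S.weight_nonneg i).eq_or_lt with hi | hi
  · rw [snapAngle, if_pos hi.symm, ← hi, mul_zero, add_zero, one_mul, zeroStep,
      ← mul_div_assoc, div_le_div_iff₀ (by positivity) (by norm_num)]
    have h1 : 2 * S.radius i ≤ S.aConst * (S.gap i + 1) := by nlinarith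
    have h2 := mul_le_mul_of_nonneg_left h1 (mul_pos hε hg).le
    linarith
  · have h := S.radius_mul_snapAngle_le_of_pos hn hε hi
    have hmg : min (S.gap i) (S.radius i) ≤ S.gap i := min_le_left _ _
    have hmr : min (S.gap i) (S.radius i) ≤ S.radius i := min_le_right _ _
    have hm0 : 0 < min (S.gap i) (S.radius i) := lt_min hg hR
    have hs := S.snapAngle_nonneg hn hε i
    set μ := min (S.gap i) (S.radius i)
    -- The weight bound `π / 2` enters here, through `1 + π² / 4 < 3.5`. The constants then fit:
    -- `3.5 * 0.8 = 2.8` is below `5.71 / 2`, where `5.71 = 1 + 3 * 3.14 / 2`.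
    have h1 : 1 + π / 2 * S.weight i ≤ 3.5 := by nlinarith [hweight i]
    have h2 : 5.71 * μ ≤ S.aConst * S.gap i := by nlinarith
    have h3 : S.aConst * ((1 + π / 2 * S.weight i) * (S.radius i * S.snapAngle ε i)) ≤
        S.aConst * (ε * S.gap i / 2) := by
      calc _ = (1 + π / 2 * S.weight i) * (S.aConst * (S.radius i * S.snapAngle ε i)) := by ring
        _ ≤ 3.5 * (0.8 * (ε * μ)) := mul_le_mul h1 h (by positivity) (by norm_num)
        _ ≤ ε / 2 * (5.71 * μ) := by nlinarith [mul_pos hε hm0]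
        _ ≤ ε / 2 * (S.aConst * S.gap i) := by gcongr
        _ = _ := by ring
    exact le_of_mul_le_mul_left h3 (by linarith)

theorem snapAngle_le_of_pos {i : Fin n} (hi : 0 < S.weight i) : S.snapAngle ε i ≤ ε := by
  have ha := S.one_le_aConst hn
  have h := S.radius_mul_snapAngle_le_of_pos hn hε hi
  have hR := S.radius_pos i
  have hs := S.snapAngle_nonneg hn hε i
  have hmr : min (S.gap i) (S.radius i) ≤ S.radius i := min_le_right _ _
  have h1 : ε * min (S.gap i) (S.radius i) ≤ ε * S.radius i := by gcongr
  have h2 : 1 * (S.radius i * S.snapAngle ε i) ≤ S.aConst * (S.radius i * S.snapAngle ε i) := by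
    gcongr
  have h3 : S.radius i * S.snapAngle ε i ≤ S.radius i * ε := by nlinarith [mul_pos hε hR]
  exact le_of_mul_le_mul_left h3 hR

variable (hε' : ∀ i, 0 < S.weight i → ε ≤ S.aConst * π / (2 * S.weight i))
include hε'

omit hε in
theorem ratio_le_one {i : Fin n} (hi : 0 < S.weight i) :
    2 * S.weight i * ε / (S.aConst * π) ≤ 1 := by
  have ha := S.one_le_aConst hn
  have h := hε' i hi
  rw [le_div_iff₀ (by positivity)] at h
  rw [div_le_one (by positivity)]
  linarith

omit hε in
theorem snapAngle_le_pi_div_two {i : Fin n} (hi : 0 < S.weight i) :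
    S.snapAngle ε i ≤ π / 2 := by
  have hk5 := S.five_le_numCenters hn hi
  rw [snapAngle, if_neg hi.ne']
  refine (mul_le_of_le_one_left (by positivity) (S.ratio_le_one hn hε' hi)).trans ?_
  rw [div_le_div_iff₀ (by linarith) (by norm_num)]
  nlinarith [pi_pos]

theorem le_min_mul_sin {i : Fin n} (hi : 0 < S.weight i) {x : ℝ} (hx : 0 ≤ x)
    (hx' : x ≤ S.snapAngle ε i) : x ≤ min (π / 2) (1 + ε) * sin x := by
  have h1 := S.snapAngle_le_of_pos hn hε hi
  have h2 := S.snapAngle_le_pi_div_two hn hε' hi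
  have h3 := mul_le_sin hx (hx'.trans h2)
  have h4 : x ≤ π / 2 * sin x := by
    calc x = π / 2 * (2 / π * x) := by field_simp
      _ ≤ _ := by gcongr
  rcases min_choice (π / 2) (1 + ε) with h | h <;> rw [h]
  · exact h4
  · rcases le_total ε 1 with h5 | h5
    · exact le_one_add_mul_sin hx (hx'.trans h1) h5
    · refine h4.trans (mul_le_mul_of_nonneg_right ?_ ?_)
      · linarith [pi_lt_four]
      · exact sin_nonneg_of_nonneg_of_le_pi hx (by linarith [pi_pos])

end WeightedDisks

end

/-! ### Every boundary point has a node nearby; finiteness -/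

section

open Set Filter Topology

namespace WeightedDisks

variable {n : ℕ} (S : WeightedDisks n)

theorem pt_add_int_mul (i : Fin n) (θ : ℝ) (m : ℤ) : S.pt i (θ + m * (2 * π)) = S.pt i θ :=
  (periodic_circleMap (S.center i) (S.radius i)).int_mul m θ

theorem pt_mem_sphere (i : Fin n) (θ : ℝ) :
    S.pt i θ ∈ Metric.sphere (S.center i) (S.radius i) :=
  circleMap_mem_sphere _ (S.radius_pos i).le _

theorem exists_pt_eq (i : Fin n) {z : ℂ} (hz : z ∈ Metric.sphere (S.center i) (S.radius i)) :
    ∃ θ, S.pt i θ = z := by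
  have := range_circleMap (S.center i) (S.radius i)
  rw [abs_of_pos (S.radius_pos i)] at this
  rwa [← this] at hz

theorem pt_sub_center (i : Fin n) (θ : ℝ) :
    S.pt i θ - S.center i = S.radius i * Complex.exp (θ * Complex.I) := by
  simp [pt, circleMap]

theorem pt_sub_center_ne_zero (i : Fin n) (θ : ℝ) : S.pt i θ - S.center i ≠ 0 := by
  rw [pt_sub_center]
  exact mul_ne_zero (by exact_mod_cast (S.radius_pos i).ne') (Complex.exp_ne_zero _)

theorem centralAngle_pt (i : Fin n) {θ ψ : ℝ} (h : |ψ| ≤ π) :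
    S.centralAngle i (S.pt i (θ + ψ)) (S.pt i θ) = |ψ| := by
  have hd : (S.pt i (θ + ψ) - S.center i) / (S.pt i θ - S.center i) =
      Complex.exp (ψ * Complex.I) := by
    rw [div_eq_iff (S.pt_sub_center_ne_zero i θ), pt_sub_center, pt_sub_center, mul_left_comm,
      ← Complex.exp_add]
    congr 2
    push_cast
    ring
  rw [centralAngle, Complex.angle_eq_abs_arg (S.pt_sub_center_ne_zero i _)
    (S.pt_sub_center_ne_zero i _), hd, Complex.arg_exp_mul_I]
  -- The argument lies in `(-π, π]`, so `ψ = -π` needs separate treatment.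
  rcases (abs_le.1 h).1.eq_or_lt with h1 | h1
  · rw [← h1]
    have : toIocMod two_pi_pos (-π) (-π) = π := by
      rw [toIocMod_apply_left]; ring
    rw [this, abs_neg]
  · rw [(toIocMod_eq_self two_pi_pos).2 ⟨h1, by linarith [(abs_le.1 h).2]⟩]

theorem centralAngle_pt_le (i : Fin n) (θ ψ : ℝ) :
    S.centralAngle i (S.pt i (θ + ψ)) (S.pt i θ) ≤ |ψ| := by
  rcases le_total |ψ| π with h | h
  · exact (S.centralAngle_pt i h).le
  · exact (S.centralAngle_le_pi i _ _).trans h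

theorem dist_pt (i : Fin n) {θ ψ : ℝ} (h : |ψ| ≤ π) :
    dist (S.pt i (θ + ψ)) (S.pt i θ) = 2 * S.radius i * sin (|ψ| / 2) := by
  rw [S.dist_eq_two_mul_sin_centralAngle i (S.pt_mem_sphere i _) (S.pt_mem_sphere i _),
    S.centralAngle_pt i h]

theorem dist_pt_le (i : Fin n) (θ ψ : ℝ) :
    dist (S.pt i (θ + ψ)) (S.pt i θ) ≤ S.radius i * |ψ| := by
  have h := (lipschitzWith_circleMap (S.center i) (S.radius i)).dist_le_mul (θ + ψ) θ
  rw [Real.dist_eq, add_sub_cancel_left] at h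
  simpa [pt, abs_of_pos (S.radius_pos i)] using h

/-- Geometric sum. With `r = 2 ω ε / (a π)`, the central angle from the vicinity center to its
`l`-th ring point is `π (1 - r) ^ l`. -/
theorem ringAngle_eq (hn : 2 ≤ n) (ε : ℝ) (i : Fin n) (l : ℕ) :
    S.ringAngle ε i l = π / 2 * (1 - (1 - 2 * S.weight i * ε / (S.aConst * π)) ^ l) := by
  have ha := S.one_le_aConst hn
  induction l with
  | zero => simp [ringAngle]
  | succ l ih =>
    rw [ringAngle, Finset.sum_range_succ]
    rw [ringAngle] at ih
    rw [ih, pow_succ]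
    have : S.weight i * ε / S.aConst = π / 2 * (2 * S.weight i * ε / (S.aConst * π)) := by
      have := pi_pos
      field_simp
    rw [this]
    ring

/-- Indexing the centers by all integers, reduced modulo their number, lets neighbors wrap around
the circle. -/
theorem exists_centerAngle (hn : 2 ≤ n) (ε : ℝ) (θ₀ : Fin n → ℝ) {i : Fin n}
    (hi : 0 < S.weight i) (J : ℤ) : ∃ φ ∈ S.centerAngles ε θ₀ i, ∃ m : ℤ,
      θ₀ i + 2 * π * J / S.numCenters i = φ + m * (2 * π) := by
  have hk := S.five_le_numCenters hn hi
  have hk0 : 0 < (S.numCenters i : ℤ) := by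
    have : (0 : ℝ) < S.numCenters i := by linarith
    exact_mod_cast this
  rw [centerAngles, if_neg hi.ne']
  have h1 := Int.emod_nonneg J hk0.ne'
  have h2 := Int.emod_lt_of_pos J hk0
  obtain ⟨j, hj⟩ := Int.eq_ofNat_of_zero_le h1
  refine ⟨_, ⟨j, by omega, rfl⟩, J / S.numCenters i, ?_⟩
  have h3 : (J : ℝ) = S.numCenters i * ((J / S.numCenters i : ℤ) : ℝ) + j := by
    have := Int.mul_ediv_add_emod J (S.numCenters i)
    rw [hj] at this
    exact_mod_cast this.symm
  rw [h3]
  field_simp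
  ring

theorem pt_mem_annularSteinerPoints (hn : 2 ≤ n) (ε : ℝ) (θ₀ : Fin n → ℝ) {i : Fin n}
    (hi : 0 < S.weight i) (J : ℤ) :
    S.pt i (θ₀ i + 2 * π * J / S.numCenters i) ∈ S.annularSteinerPoints ε θ₀ i := by
  obtain ⟨φ, hφ, m, h⟩ := S.exists_centerAngle hn ε θ₀ hi J
  rw [h, pt_add_int_mul]
  exact Or.inl ⟨φ, hφ, rfl⟩

theorem ring_mem_annularSteinerPoints (hn : 2 ≤ n) (ε : ℝ)
    (θ₀ : Fin n → ℝ) {i : Fin n} (hi : 0 < S.weight i) (J : ℤ) {s : ℝ} (hs : s = 1 ∨ s = -1)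
    (l : ℕ) (hl : 2 * S.angularRadius i ≤
      π * (1 - 2 * S.weight i * ε / (S.aConst * π)) ^ l)
    (hl' : π * (1 - 2 * S.weight i * ε / (S.aConst * π)) ^ l ≤ 2 * π / S.numCenters i) :
    S.pt i (θ₀ i + 2 * π * J / S.numCenters i -
      s * (π * (1 - 2 * S.weight i * ε / (S.aConst * π)) ^ l)) ∈
        S.annularSteinerPoints ε θ₀ i := by
  have hring := S.ringAngle_eq hn ε i l
  have hk := S.five_le_numCenters hn hi
  have hα := S.angularRadius_pos hn hi
  set q := 1 - 2 * S.weight i * ε / (S.aConst * π)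
  obtain ⟨φ, hφ, m, h⟩ := S.exists_centerAngle hn ε θ₀ hi J
  have hpt : ∀ x, S.pt i (θ₀ i + 2 * π * J / S.numCenters i - x) = S.pt i (φ - x) := by
    intro x
    rw [h, add_sub_right_comm, pt_add_int_mul]
  rw [hpt]
  refine Or.inr ⟨hi.ne', φ, hφ, ⟨l, by rw [hring]; linarith, ?_⟩, ?_⟩
  · rcases hs with rfl | rfl
    · left
      rw [hring, ← S.pt_add_int_mul i (φ - _) 1]
      congr 1
      push_cast
      ring
    · right
      rw [hring]
      congr 1
      ring
  · have habs : |-(s * (π * q ^ l))| = π * q ^ l := by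
      rw [abs_neg, abs_mul, abs_of_nonneg (by linarith : (0 : ℝ) ≤ π * q ^ l)]
      rcases hs with rfl | rfl <;> simp
    have h2 : 2 * π / S.numCenters i ≤ π := by
      rw [div_le_iff₀ (by linarith)]
      nlinarith [pi_pos]
    rw [sub_eq_add_neg, S.dist_pt i (by rw [habs]; linarith), habs]
    have hR := S.radius_pos i
    gcongr
    refine sin_le_sin_of_le_of_le_pi_div_two (by linarith [pi_pos]) ?_ ?_
    · have : π / S.numCenters i = 2 * π / S.numCenters i / 2 := by ring
      linarith
    · have : π / S.numCenters i = 2 * π / S.numCenters i / 2 := by ring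
      linarith

/-- A point at central angle `β` from a center lies between two consecutive terms of the progression
`π (1 - r) ^ l`. As `β ≥ π / k ≥ 2 α`, the term above `β` still obeys the bound that ends the ring.
The sign `s` selects the half circle. -/
theorem exists_pt_near_of_far_center (hn : 2 ≤ n) {ε : ℝ} (hε : 0 < ε)
    (hε' : ∀ i, 0 < S.weight i → ε ≤ S.aConst * π / (2 * S.weight i))
    (θ₀ : Fin n → ℝ) {i : Fin n} (hi : 0 < S.weight i) (J : ℤ) {s : ℤ} (hs : s = 1 ∨ s = -1)
    {β : ℝ} (hβ : π / S.numCenters i ≤ β) (hβ' : β ≤ 2 * π / S.numCenters i) :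
    ∃ χ, |χ| ≤ S.snapAngle ε i ∧
      S.pt i (θ₀ i + 2 * π * J / S.numCenters i - s * β + χ) ∈ S.annularSteinerPoints ε θ₀ i := by
  have hk := S.five_le_numCenters hn hi
  have hα := S.two_mul_angularRadius_le hn hi
  have hr1 := S.ratio_le_one hn hε' hi
  have ha := S.one_le_aConst hn
  have hr0 : 0 < 2 * S.weight i * ε / (S.aConst * π) := by positivity
  have hring := fun l ↦ S.ring_mem_annularSteinerPoints hn ε θ₀ hi J (s := s)
    (by rcases hs with rfl | rfl <;> simp) l
  have hβ0 : 0 < β := lt_of_lt_of_le (by positivity) hβ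
  have hβpi : β ≤ π := by
    refine hβ'.trans ?_
    rw [div_le_iff₀ (by linarith)]
    nlinarith [pi_pos]
  rw [snapAngle, if_neg hi.ne']
  have habs : ∀ x : ℝ, |(-(s * x) : ℝ)| = |x| := by
    intro x
    rcases hs with rfl | rfl <;> simp
  set r := 2 * S.weight i * ε / (S.aConst * π)
  have hex : ∃ l : ℕ, π * (1 - r) ^ l < β := by
    obtain ⟨l, hl⟩ := exists_pow_lt_of_lt_one (show 0 < β / π by positivity)
      (show 1 - r < 1 by linarith)
    exact ⟨l, by rw [lt_div_iff₀ pi_pos] at hl; linarith⟩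
  classical
  obtain ⟨l, hl⟩ : ∃ l, Nat.find hex = l + 1 := by
    refine Nat.exists_eq_succ_of_ne_zero fun h0 ↦ ?_
    have := Nat.find_spec hex
    rw [h0, pow_zero] at this
    linarith
  have h1 : π * (1 - r) ^ (l + 1) < β := hl ▸ Nat.find_spec hex
  have h2 : β ≤ π * (1 - r) ^ l := not_lt.1 (Nat.find_min hex (by omega))
  rw [pow_succ] at h1
  -- The outer ring point is used if it is kept, that is, not beyond the neighboring center.
  -- Otherwise that neighbor is used, and `β > (1 - r) * (2 * π / k)`. Both displacements are at
  -- most `r * (2 * π / k)`.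
  rcases le_total (π * (1 - r) ^ l) (2 * π / S.numCenters i) with h3 | h3
  · refine ⟨-(s * (π * (1 - r) ^ l - β)), ?_, ?_⟩
    · rw [habs, abs_of_nonneg (by linarith)]
      have := mul_le_mul_of_nonneg_left h3 hr0.le
      nlinarith
    · have := hring l (by linarith) h3
      convert this using 2
      ring
  · refine ⟨-(s * (2 * π / S.numCenters i - β)), ?_, ?_⟩
    · rw [habs, abs_of_nonneg (by linarith)]
      have := mul_le_mul_of_nonneg_left h3 (by linarith : 0 ≤ 1 - r)
      nlinarith
    · have := S.pt_mem_annularSteinerPoints hn ε θ₀ hi (J - s)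
      convert this using 2
      push_cast
      ring

/-- Every point of the `i`-th circle has a Steiner point within the central angle `snapAngle`. -/
theorem exists_pt_near (hn : 2 ≤ n) {ε : ℝ} (hε : 0 < ε)
    (hε' : ∀ i, 0 < S.weight i → ε ≤ S.aConst * π / (2 * S.weight i))
    (θ₀ : Fin n → ℝ) (i : Fin n) (θ : ℝ) : ∃ χ, |χ| ≤ S.snapAngle ε i ∧
      S.pt i (θ + χ) ∈ S.annularSteinerPoints ε θ₀ i := by
  rcases (S.weight_nonneg i).eq_or_lt with hi | hi
  · have hz := S.zeroStep_pos hn hε i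
    rw [snapAngle, if_pos hi.symm]
    obtain ⟨h0, h2⟩ := toIcoMod_mem_Ico two_pi_pos 0 (θ - θ₀ i)
    have he := toIcoMod_add_toIcoDiv_zsmul two_pi_pos 0 (θ - θ₀ i)
    set x := toIcoMod two_pi_pos 0 (θ - θ₀ i)
    set m := toIcoDiv two_pi_pos 0 (θ - θ₀ i)
    have hl := Nat.floor_le (a := x / S.zeroStep ε i) (by positivity)
    have hl' := Nat.lt_floor_add_one (x / S.zeroStep ε i)
    set l := ⌊x / S.zeroStep ε i⌋₊
    rw [le_div_iff₀ hz] at hl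
    rw [div_lt_iff₀ hz] at hl'
    refine ⟨l * S.zeroStep ε i - x, by rw [abs_le]; constructor <;> linarith, Or.inl ?_⟩
    refine ⟨θ₀ i + l * S.zeroStep ε i, ?_, ?_⟩
    · rw [centerAngles, if_pos hi.symm]
      exact ⟨l, by linarith, rfl⟩
    · rw [← S.pt_add_int_mul i _ m]
      congr 1
      rw [zsmul_eq_mul] at he
      linarith
  · have hk := S.five_le_numCenters hn hi
    have hstep : 0 < 2 * π / S.numCenters i := by
      have := pi_pos
      positivity
    have h1 := Int.floor_le ((θ - θ₀ i) / (2 * π / S.numCenters i))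
    have h2 := Int.lt_floor_add_one ((θ - θ₀ i) / (2 * π / S.numCenters i))
    set J := ⌊(θ - θ₀ i) / (2 * π / S.numCenters i)⌋
    rw [le_div_iff₀ hstep] at h1
    rw [div_lt_iff₀ hstep] at h2
    have hhalf : π / S.numCenters i = 2 * π / S.numCenters i / 2 := by ring
    have hJ : 2 * π * J / S.numCenters i = J * (2 * π / S.numCenters i) := by ring
    have hJ' : 2 * π * (J + 1 : ℤ) / S.numCenters i = (J + 1) * (2 * π / S.numCenters i) := by
      push_cast
      ring
    -- Of the two centers surrounding the point, the farther one is chosen, so that `β` lies in the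
    -- upper half of the step.
    rcases le_total (θ - θ₀ i - J * (2 * π / S.numCenters i)) (π / S.numCenters i) with h | h
    · obtain ⟨χ, hχ, hmem⟩ := S.exists_pt_near_of_far_center hn hε hε' θ₀ hi (J + 1) (Or.inl rfl)
        (β := (J + 1) * (2 * π / S.numCenters i) - (θ - θ₀ i)) (by linarith) (by linarith)
      refine ⟨χ, hχ, ?_⟩
      rw [hJ'] at hmem
      convert hmem using 2
      push_cast
      ring
    · obtain ⟨χ, hχ, hmem⟩ := S.exists_pt_near_of_far_center hn hε hε' θ₀ hi J (Or.inr rfl)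
        (β := θ - θ₀ i - J * (2 * π / S.numCenters i)) (by linarith) (by linarith)
      refine ⟨χ, hχ, ?_⟩
      rw [hJ] at hmem
      convert hmem using 2
      push_cast
      ring

theorem finite_centerAngles (hn : 2 ≤ n) {ε : ℝ} (hε : 0 < ε) (θ₀ : Fin n → ℝ) (i : Fin n) :
    (S.centerAngles ε θ₀ i).Finite := by
  rw [centerAngles]
  split_ifs with hi
  · have hz := S.zeroStep_pos hn hε i
    refine ((finite_Iio (⌈2 * π / S.zeroStep ε i⌉₊)).image
      fun l : ℕ ↦ θ₀ i + l * S.zeroStep ε i).subset ?_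
    rintro φ ⟨l, hl, rfl⟩
    exact ⟨l, Nat.lt_ceil.2 ((lt_div_iff₀ hz).2 hl), rfl⟩
  · refine ((finite_Iio (S.numCenters i)).image
      fun j : ℕ ↦ θ₀ i + 2 * π * j / S.numCenters i).subset ?_
    rintro φ ⟨j, hj, rfl⟩
    exact ⟨j, hj, rfl⟩

/-- Since `0 < r ≤ 1`, the powers `(1 - r) ^ l` fall below `2 α / π`, which ends every ring. -/
theorem finite_steinerPoints (hn : 2 ≤ n) {ε : ℝ} (hε : 0 < ε)
    (hε' : ∀ i, 0 < S.weight i → ε ≤ S.aConst * π / (2 * S.weight i))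
    (θ₀ : Fin n → ℝ) (i : Fin n) : (S.steinerPoints ε θ₀ i).Finite := by
  have hfin := S.finite_centerAngles hn hε θ₀ i
  refine (hfin.image _).union ?_
  rcases (S.weight_nonneg i).eq_or_lt with hi | hi
  · simp [← hi]
  have ha := S.one_le_aConst hn
  have hα := S.angularRadius_pos hn hi
  have hr1 := S.ratio_le_one hn hε' hi
  have hr0 : 0 < 2 * S.weight i * ε / (S.aConst * π) := by positivity
  obtain ⟨N, hN⟩ := exists_pow_lt_of_lt_one (show 0 < 2 * S.angularRadius i / π by positivity)
    (show 1 - 2 * S.weight i * ε / (S.aConst * π) < 1 by linarith)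
  rw [lt_div_iff₀ pi_pos] at hN
  refine (hfin.biUnion fun φ _ ↦ (((finite_Iio N).image
    fun l ↦ S.pt i (φ + π + 2 * S.ringAngle ε i l)).union ((finite_Iio N).image
    fun l ↦ S.pt i (φ + π - 2 * S.ringAngle ε i l)))).subset ?_
  rintro x ⟨-, φ, hφ, l, hl, hx⟩
  have hlN : l < N := by
    by_contra hcon
    rw [not_lt] at hcon
    rw [S.ringAngle_eq hn] at hl
    have h1 := pow_le_pow_of_le_one (sub_nonneg.2 hr1) (by linarith) hcon
    nlinarith [pi_pos]
  refine mem_biUnion hφ ?_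
  rcases hx with rfl | rfl
  · exact Or.inl ⟨l, hlN, rfl⟩
  · exact Or.inr ⟨l, hlN, rfl⟩

end WeightedDisks

end

/-! ### Bounding edge weights and building walks -/

section

open Set Filter Topology

theorem Path.eVariationOn_extend_le {x y : ℂ} (p : Path x y) (f : ℝ → ℂ)
    (h : ∀ t : unitInterval, p t = f t) :
    eVariationOn p.extend univ ≤ eVariationOn f (Icc 0 1) := by
  have : (p.extend : ℝ → ℂ) = f ∘ fun τ ↦ (projIcc (0 : ℝ) 1 zero_le_one τ : ℝ) := by
    funext τ
    exact h _
  rw [this]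
  exact eVariationOn.comp_le_of_monotoneOn _ _
    (fun _ _ _ _ hab ↦ monotone_projIcc zero_le_one hab) fun τ _ ↦ (projIcc 0 1 zero_le_one τ).2

theorem Path.eVariationOn_extend_trans_le {x y z : ℂ} (p : Path x y) (q : Path y z) :
    eVariationOn (p.trans q).extend univ ≤
      eVariationOn p.extend univ + eVariationOn q.extend univ := by
  have h := eVariationOn.union (p.trans q).extend (s := Iic (1 / 2)) (t := Ici (1 / 2))
    isGreatest_Iic isLeast_Ici
  rw [Iic_union_Ici] at h
  rw [h]
  refine add_le_add ?_ ?_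
  · rw [eVariationOn.congr (f := (p.trans q).extend) (g := p.extend ∘ fun τ : ℝ ↦ 2 * τ)
      (s := Iic (1 / 2)) fun τ hτ ↦ Path.extend_trans_of_le_half p q hτ]
    exact eVariationOn.comp_le_of_monotoneOn _ _ (fun a _ b _ hab ↦ by linarith)
      (mapsTo_univ _ _)
  · rw [eVariationOn.congr (f := (p.trans q).extend) (g := q.extend ∘ fun τ : ℝ ↦ 2 * τ - 1)
      (s := Ici (1 / 2)) fun τ hτ ↦ Path.extend_trans_of_half_le p q hτ]
    exact eVariationOn.comp_le_of_monotoneOn _ _ (fun a _ b _ hab ↦ by linarith)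
      (mapsTo_univ _ _)

theorem RectifiablePath.exists_path_portion {x y : ℂ} (γ : RectifiablePath x y) {a b : ℝ}
    (hab : a ≤ b) : ∃ p : Path (γ.toPath.extend a) (γ.toPath.extend b),
      eVariationOn p.extend univ ≤ γ.arcLength (Ioo a b) ∧
      ∀ t, ∃ τ ∈ Icc a b, p t = γ.toPath.extend τ := by
  have hmem : ∀ t ∈ Icc (0 : ℝ) 1, a + t * (b - a) ∈ Icc a b := by
    intro t ht
    constructor <;> nlinarith [ht.1, ht.2]
  let p : Path (γ.toPath.extend a) (γ.toPath.extend b) :=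
    { toFun := fun t ↦ γ.toPath.extend (a + t * (b - a))
      continuous_toFun := γ.continuous_extend.comp (by fun_prop)
      source' := by simp
      target' := by simp }
  refine ⟨p, ?_, fun t ↦ ⟨_, hmem t t.2, rfl⟩⟩
  rw [γ.arcLength_Ioo hab]
  refine (p.eVariationOn_extend_le (γ.toPath.extend ∘ fun t ↦ a + t * (b - a))
    fun t ↦ rfl).trans ?_
  refine eVariationOn.comp_le_of_monotoneOn _ _ (fun s _ t _ hst ↦ ?_) hmem
  have := mul_le_mul_of_nonneg_right hst (sub_nonneg.2 hab)
  linarith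

namespace WeightedDisks

variable {n : ℕ} (S : WeightedDisks n)

theorem exists_arc (i : Fin n) (a b : ℝ) : ∃ p : Path (S.pt i a) (S.pt i b),
    eVariationOn p.extend univ ≤ ENNReal.ofReal (S.radius i * |b - a|) ∧
      ∀ t, p t ∈ Metric.sphere (S.center i) (S.radius i) := by
  have hlip : LipschitzWith (S.radius i * |b - a|).toNNReal
      fun t : ℝ ↦ S.pt i (a + t * (b - a)) := by
    refine LipschitzWith.of_dist_le_mul fun s t ↦ ?_
    have hR := S.radius_pos i
    rw [Real.coe_toNNReal _ (by positivity)]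
    have h := S.dist_pt_le i (a + t * (b - a)) ((s - t) * (b - a))
    rw [show a + t * (b - a) + (s - t) * (b - a) = a + s * (b - a) by ring, abs_mul] at h
    rw [Real.dist_eq]
    linarith
  let p : Path (S.pt i a) (S.pt i b) :=
    { toFun := fun t ↦ S.pt i (a + t * (b - a))
      continuous_toFun := hlip.continuous.comp continuous_subtype_val
      source' := by simp
      target' := by simp }
  refine ⟨p, ?_, fun t ↦ S.pt_mem_sphere i _⟩
  refine (p.eVariationOn_extend_le ((fun t : ℝ ↦ S.pt i (a + t * (b - a))) ∘ id)
    fun t ↦ rfl).trans ?_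
  refine (hlip.lipschitzOnWith.comp_eVariationOn_le (mapsTo_univ _ _)).trans ?_
  rw [eVariationOn_id_Icc]
  simp [ENNReal.ofReal]

theorem notMem_ball_of_mem_sphere {i : Fin n} {z : ℂ}
    (hz : z ∈ Metric.sphere (S.center i) (S.radius i)) (j : Fin n) :
    z ∉ Metric.ball (S.center j) (S.radius j) := by
  intro hj
  rcases eq_or_ne i j with rfl | hij
  · rw [Metric.mem_sphere] at hz
    rw [Metric.mem_ball] at hj
    linarith
  · exact Set.disjoint_left.1 (S.disjoint i j hij) (Metric.sphere_subset_closedBall hz)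
      (Metric.ball_subset_closedBall hj)

/-- A boundary arc, the outside portion of the path and a second arc concatenate to a competitor
that avoids all interiors. -/
theorem detourLength_le {x y : ℂ} (γ : RectifiablePath x y) {i j : Fin n} {a b : ℝ} (hab : a ≤ b)
    {θ θ' χ χ' : ℝ} (ha : γ.toPath.extend a = S.pt i θ) (hb : γ.toPath.extend b = S.pt j θ')
    (hout : ∀ τ ∈ Ioo a b, ∀ k, γ.toPath.extend τ ∉
      Metric.closedBall (S.center k) (S.radius k)) :
    S.detourLength (S.pt i (θ + χ)) (S.pt j (θ' + χ')) ≤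
      ENNReal.ofReal (S.radius i * |χ|) +
        (γ.arcLength (Ioo a b) + ENNReal.ofReal (S.radius j * |χ'|)) := by
  obtain ⟨p, hp, hps⟩ := S.exists_arc i (θ + χ) θ
  obtain ⟨q, hq, hqs⟩ := S.exists_arc j θ' (θ' + χ')
  obtain ⟨r, hr, hrs⟩ := γ.exists_path_portion hab
  rw [sub_add_cancel_left, abs_neg] at hp
  rw [add_sub_cancel_left] at hq
  have hv : eVariationOn ((p.trans ((r.cast ha.symm hb.symm).trans q)).extend) univ ≤
      ENNReal.ofReal (S.radius i * |χ|) +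
        (γ.arcLength (Ioo a b) + ENNReal.ofReal (S.radius j * |χ'|)) := by
    refine (Path.eVariationOn_extend_trans_le _ _).trans (add_le_add hp ?_)
    refine (Path.eVariationOn_extend_trans_le _ _).trans (add_le_add ?_ hq)
    exact hr
  have hball : ∀ t k, (p.trans ((r.cast ha.symm hb.symm).trans q)) t ∉
      Metric.ball (S.center k) (S.radius k) := by
    intro t k
    have hmem : (p.trans ((r.cast ha.symm hb.symm).trans q)) t ∈
        range p ∪ (range r ∪ range q) := by
      have := mem_range_self (f := (p.trans ((r.cast ha.symm hb.symm).trans q))) t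
      rwa [Path.trans_range, Path.trans_range, Path.cast_coe] at this
    rcases hmem with ⟨s, hs⟩ | ⟨s, hs⟩ | ⟨s, hs⟩
    · rw [← hs]
      exact S.notMem_ball_of_mem_sphere (hps s) k
    · rw [← hs]
      obtain ⟨τ, hτ, e⟩ := hrs s
      rw [e]
      rcases hτ.1.eq_or_lt with rfl | h1
      · rw [ha]
        exact S.notMem_ball_of_mem_sphere (S.pt_mem_sphere i θ) k
      rcases hτ.2.eq_or_lt with rfl | h2
      · rw [hb]
        exact S.notMem_ball_of_mem_sphere (S.pt_mem_sphere j θ') k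
      exact fun h ↦ hout τ ⟨h1, h2⟩ k (Metric.ball_subset_closedBall h)
    · rw [← hs]
      exact S.notMem_ball_of_mem_sphere (hqs s) k
  let P : RectifiablePath (S.pt i (θ + χ)) (S.pt j (θ' + χ')) :=
    { toPath := p.trans ((r.cast ha.symm hb.symm).trans q)
      rectifiable := by
        refine ne_top_of_le_ne_top ?_ hv
        have : γ.arcLength (Ioo a b) ≠ ⊤ := by
          rw [γ.arcLength_Ioo hab]
          exact ne_top_of_le_ne_top γ.rectifiable (eVariationOn.mono _ (subset_univ _))
        finiteness }
  refine (iInf₂_le P hball).trans ((S.weightedLength_le_eVariationOn P hball).trans hv)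

variable {V : Fin n → Set ℂ}

/-- The node `v` can be reached from `u` by a walk of weighted length at most `L`. -/
def Reach (u v : Node V) (L : ENNReal) : Prop :=
  ∃ p : (⊤ : SimpleGraph (Node V)).Walk u v, S.graphLength p ≤ L

namespace Reach

variable {S}

theorem refl (u : Node V) (L : ENNReal) : S.Reach u u L :=
  ⟨.nil, by simp [graphLength]⟩

theorem mono {u v : Node V} {L L' : ENNReal} (h : S.Reach u v L) (hL : L ≤ L') :
    S.Reach u v L' :=
  h.imp fun _ hp ↦ hp.trans hL

theorem trans {u v w : Node V} {L L' : ENNReal} (h : S.Reach u v L) (h' : S.Reach v w L') :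
    S.Reach u w (L + L') := by
  obtain ⟨p, hp⟩ := h
  obtain ⟨q, hq⟩ := h'
  refine ⟨p.append q, ?_⟩
  rw [graphLength, SimpleGraph.Walk.darts_append, List.map_append, List.sum_append]
  exact add_le_add hp hq

theorem of_edgeWeight_le {u v : Node V} {L : ENNReal} (h : u ≠ v → S.edgeWeight V u v ≤ L) :
    S.Reach u v L := by
  by_cases huv : u = v
  · subst huv
    exact refl u L
  · exact ⟨.cons (SimpleGraph.top_adj u v |>.2 huv) .nil, by simpa [graphLength] using h huv⟩

end Reach

theorem FreeArc.symm {i : Fin n} {u v : ℂ} {ψ : ℝ} (h : S.FreeArc V i u v ψ) :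
    S.FreeArc V i v u ψ := by
  obtain ⟨h0, θ, h1, h2⟩ := h
  exact ⟨h0, θ, h1.symm, h2⟩

theorem reach_of_freeArc {i : Fin n} (u v : V i) {ψ : ℝ} (h : S.FreeArc V i u v ψ) :
    S.Reach (⟨i, u⟩ : Node V) ⟨i, v⟩
      (ENNReal.ofReal (min 1 (S.weight i) * (S.radius i * ψ))) := by
  refine Reach.of_edgeWeight_le fun _ ↦ ?_
  rw [edgeWeight, if_pos rfl, if_pos ⟨ψ, h⟩]
  exact iInf₂_le ψ h

/-- On an arc of at most half a circle distinct angles give distinct points, so finiteness of `V i`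
passes to angles. -/
theorem finite_arc (hfin : ∀ i, (V i).Finite) (i : Fin n) (θ : ℝ) {ψ : ℝ} (hψ : ψ ≤ π) :
    {χ | χ ∈ Ioo 0 ψ ∧ S.pt i (θ + χ) ∈ V i}.Finite := by
  refine Finite.of_finite_image ((hfin i).subset (image_subset_iff.2 fun χ hχ ↦ hχ.2) :
    ((fun χ ↦ S.pt i (θ + χ)) '' {χ | χ ∈ Ioo 0 ψ ∧ S.pt i (θ + χ) ∈ V i}).Finite) ?_
  rintro a ⟨ha, -⟩ b ⟨hb, -⟩ hab
  have habs : |a - b| ≤ π := by rw [abs_le]; constructor <;> linarith [ha.1, ha.2, hb.1, hb.2]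
  have h := S.centralAngle_pt i (θ := θ + b) habs
  rw [show θ + b + (a - b) = θ + a by ring, show S.pt i (θ + a) = S.pt i (θ + b) from hab,
    centralAngle, InnerProductGeometry.angle_self (S.pt_sub_center_ne_zero i _)] at h
  exact sub_eq_zero.1 (abs_eq_zero.1 h.symm)

/-- Induction on the number of nodes inside the arc: an arc without any is free, and otherwise it
splits at one of them. Both directions are carried along because the shorter arc between two nodes
may have either orientation. -/
theorem reach_of_arc (hfin : ∀ i, (V i).Finite) {i : Fin n} (N : ℕ) : ∀ (θ ψ : ℝ), 0 ≤ ψ →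
    ψ ≤ π → ∀ u v : V i, (u : ℂ) = S.pt i θ → (v : ℂ) = S.pt i (θ + ψ) →
    {χ | χ ∈ Ioo 0 ψ ∧ S.pt i (θ + χ) ∈ V i}.ncard < N →
    S.Reach (⟨i, u⟩ : Node V) ⟨i, v⟩
      (ENNReal.ofReal (min 1 (S.weight i) * (S.radius i * ψ))) ∧
    S.Reach (⟨i, v⟩ : Node V) ⟨i, u⟩
      (ENNReal.ofReal (min 1 (S.weight i) * (S.radius i * ψ))) := by
  have hR := S.radius_pos i
  have hm : 0 ≤ min 1 (S.weight i) := le_min zero_le_one (S.weight_nonneg i)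
  induction N with
  | zero => intro _ _ _ _ _ _ _ _ hcard; exact absurd hcard (Nat.not_lt_zero _)
  | succ N ih =>
    intro θ ψ h0 hpi u v hu hv hcard
    rcases h0.eq_or_lt with rfl | h0
    · have e : u = v := Subtype.ext (by rw [hu, hv, add_zero])
      rw [e]
      exact ⟨Reach.refl _ _, Reach.refl _ _⟩
    have hfinite := S.finite_arc hfin i θ hpi
    rcases eq_empty_or_nonempty {χ | χ ∈ Ioo 0 ψ ∧ S.pt i (θ + χ) ∈ V i} with he | ⟨χ, hχ, hw⟩
    · have hfree : S.FreeArc V i u v ψ := by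
        refine ⟨h0, θ, Or.inl ⟨hu, hv⟩, fun χ hχ hmem ↦ ?_⟩
        have : χ ∈ (∅ : Set ℝ) := he ▸ ⟨hχ, hmem⟩
        exact this
      exact ⟨S.reach_of_freeArc u v hfree, S.reach_of_freeArc v u (FreeArc.symm S hfree)⟩
    · have hcard' : ∀ s : Set ℝ, s ⊆ {χ | χ ∈ Ioo 0 ψ ∧ S.pt i (θ + χ) ∈ V i} → χ ∉ s →
          s.ncard < N := by
        intro s hs hχs
        have := ncard_lt_ncard (hs.ssubset_of_mem_notMem ⟨hχ, hw⟩ hχs) hfinite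
        omega
      obtain ⟨l₁, r₁⟩ := ih θ χ hχ.1.le (hχ.2.le.trans hpi) u ⟨_, hw⟩ hu rfl
        (hcard' _ (fun x hx ↦ ⟨⟨hx.1.1, hx.1.2.trans hχ.2⟩, hx.2⟩) fun h ↦ lt_irrefl _ h.1.2)
      obtain ⟨l₂, r₂⟩ := ih (θ + χ) (ψ - χ) (by linarith [hχ.2]) (by linarith [hχ.1]) ⟨_, hw⟩ v rfl
        (by rw [hv]; congr 1; ring) (by
          rw [← ncard_image_of_injective _ (add_right_injective χ)]
          refine hcard' _ ?_ ?_
          · rintro _ ⟨x, ⟨hx, hx'⟩, rfl⟩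
            refine ⟨⟨by linarith [hx.1, hχ.1], by linarith [hx.2]⟩, ?_⟩
            rwa [← add_assoc]
          · rintro ⟨x, ⟨hx, -⟩, hx'⟩
            simp only at hx'
            linarith [hx.1])
      have hsum : ENNReal.ofReal (min 1 (S.weight i) * (S.radius i * ψ)) =
          ENNReal.ofReal (min 1 (S.weight i) * (S.radius i * χ)) +
          ENNReal.ofReal (min 1 (S.weight i) * (S.radius i * (ψ - χ))) := by
        rw [← ENNReal.ofReal_add (mul_nonneg hm (mul_nonneg hR.le hχ.1.le))
          (mul_nonneg hm (mul_nonneg hR.le (by linarith [hχ.2])))]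
        congr 1
        ring
      rw [hsum]
      exact ⟨l₁.trans l₂, (r₂.trans r₁).mono (add_comm _ _).le⟩

theorem exists_eq_pt_add (i : Fin n) {u v : ℂ}
    (hu : u ∈ Metric.sphere (S.center i) (S.radius i))
    (hv : v ∈ Metric.sphere (S.center i) (S.radius i)) :
    ∃ θ ψ, |ψ| ≤ π ∧ u = S.pt i (θ + ψ) ∧ v = S.pt i θ := by
  obtain ⟨a, rfl⟩ := S.exists_pt_eq i hu
  obtain ⟨b, rfl⟩ := S.exists_pt_eq i hv
  have h := toIocMod_mem_Ioc two_pi_pos (-π) (a - b)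
  refine ⟨b, toIocMod two_pi_pos (-π) (a - b),
    abs_le.2 ⟨h.1.le, by linarith [h.2]⟩, ?_, rfl⟩
  have he := toIocMod_add_toIocDiv_zsmul two_pi_pos (-π) (a - b)
  rw [zsmul_eq_mul] at he
  rw [← S.pt_add_int_mul i (b + _) (toIocDiv two_pi_pos (-π) (a - b))]
  congr 1
  linarith

theorem reach_arc (hfin : ∀ i, (V i).Finite)
    (hsphere : ∀ i, V i ⊆ Metric.sphere (S.center i) (S.radius i)) {i : Fin n} (u v : V i) :
    S.Reach (⟨i, u⟩ : Node V) ⟨i, v⟩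
      (ENNReal.ofReal (min 1 (S.weight i) * (S.radius i * S.centralAngle i u v))) := by
  obtain ⟨θ, ψ, hψ, hu, hv⟩ := S.exists_eq_pt_add i (hsphere i u.2) (hsphere i v.2)
  rw [hu, hv, S.centralAngle_pt i hψ]
  rcases le_total 0 ψ with h | h
  · rw [abs_of_nonneg h] at hψ ⊢
    exact (S.reach_of_arc hfin _ θ ψ h hψ v u hv hu (Nat.lt_succ_self _)).2
  · rw [abs_of_nonpos h] at hψ ⊢
    exact (S.reach_of_arc hfin _ (θ + ψ) (-ψ) (by linarith) hψ u v hu (by rw [hv]; congr 1; ring)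
      (Nat.lt_succ_self _)).1

/-- Otherwise the node near the midpoint of the arc would lie in its interior. -/
theorem FreeArc.le_two_mul_snapAngle {ε : ℝ} {i : Fin n}
    (hnear : ∀ θ, ∃ χ, |χ| ≤ S.snapAngle ε i ∧ S.pt i (θ + χ) ∈ V i) {u v : ℂ} {ψ : ℝ}
    (h : S.FreeArc V i u v ψ) : ψ ≤ 2 * S.snapAngle ε i := by
  obtain ⟨-, θ, -, h2⟩ := h
  by_contra! hcon
  obtain ⟨χ, hχ, hmem⟩ := hnear (θ + ψ / 2)
  rw [abs_le] at hχ
  refine h2 (ψ / 2 + χ) ⟨by linarith, by linarith⟩ ?_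
  rwa [← add_assoc]

/-- Only adjacent nodes lack the chord edge; half of their free arc is at most `snapAngle`, where
`le_min_mul_sin` compares arc and chord. -/
theorem reach_chord (hn : 2 ≤ n) {ε : ℝ} (hε : 0 < ε)
    (hε' : ∀ i, 0 < S.weight i → ε ≤ S.aConst * π / (2 * S.weight i)) {i : Fin n}
    (hnear : ∀ θ, ∃ χ, |χ| ≤ S.snapAngle ε i ∧ S.pt i (θ + χ) ∈ V i) (u v : V i) :
    S.Reach (⟨i, u⟩ : Node V) ⟨i, v⟩
      (ENNReal.ofReal (min (π / 2) (1 + ε) * (S.weight i * dist (u : ℂ) v))) := by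
  have hR := S.radius_pos i
  have hω := S.weight_nonneg i
  have hm : min 1 (S.weight i) ≤ S.weight i := min_le_right _ _
  by_cases hadj : ∃ ψ, S.FreeArc V i u v ψ
  · obtain ⟨ψ, hψ⟩ := hadj
    refine (S.reach_of_freeArc u v hψ).mono (ENNReal.ofReal_le_ofReal ?_)
    rcases hω.eq_or_lt with hi | hi
    · simp [← hi]
    have hle := FreeArc.le_two_mul_snapAngle S hnear hψ
    have hpi := S.snapAngle_le_pi_div_two hn hε' hi
    obtain ⟨h0, θ, hθ, -⟩ := hψ
    have habs : |ψ| ≤ π := by rw [abs_of_pos h0]; linarith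
    have hd : dist (u : ℂ) v = 2 * S.radius i * sin (ψ / 2) := by
      have := S.dist_pt i (θ := θ) habs
      rw [abs_of_pos h0] at this
      rcases hθ with ⟨e₁, e₂⟩ | ⟨e₁, e₂⟩
      · rw [e₁, e₂, dist_comm, this]
      · rw [e₁, e₂, this]
    have hsin := S.le_min_mul_sin hn hε hε' hi (x := ψ / 2) (by linarith) (by linarith)
    rw [hd]
    calc min 1 (S.weight i) * (S.radius i * ψ)
        ≤ S.weight i * (S.radius i * ψ) := by gcongr
      _ = S.weight i * (2 * S.radius i * (ψ / 2)) := by ring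
      _ ≤ S.weight i * (2 * S.radius i * (min (π / 2) (1 + ε) * sin (ψ / 2))) := by gcongr
      _ = _ := by ring
  · refine Reach.of_edgeWeight_le fun _ ↦ ?_
    rw [edgeWeight, if_pos rfl, if_neg hadj]
    refine ENNReal.ofReal_le_ofReal (le_mul_of_one_le_left (by positivity) ?_)
    exact le_min (by linarith [pi_gt_three]) (by linarith)

/-- Moving the endpoints of a portion of a path inside the `i`-th disk to nodes. -/
theorem reach_crossing (hn : 2 ≤ n) {ε : ℝ} (hε : 0 < ε)
    (hε' : ∀ i, 0 < S.weight i → ε ≤ S.aConst * π / (2 * S.weight i)) {i : Fin n}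
    (hfin : ∀ i, (V i).Finite)
    (hsphere : ∀ i, V i ⊆ Metric.sphere (S.center i) (S.radius i))
    (hnear : ∀ θ, ∃ χ, |χ| ≤ S.snapAngle ε i ∧ S.pt i (θ + χ) ∈ V i) (u v : V i) {x y : ℂ}
    (hx : x ∈ Metric.sphere (S.center i) (S.radius i))
    (hy : y ∈ Metric.sphere (S.center i) (S.radius i)) {r ρ : ℝ}
    (hr : S.centralAngle i u x ≤ r) (hρ : S.centralAngle i y v ≤ ρ) :
    S.Reach (⟨i, u⟩ : Node V) ⟨i, v⟩
      (ENNReal.ofReal (π / 2 * S.weight i * (S.radius i * (r + ρ)) +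
        (1 + ε) * S.crossing i (S.centralAngle i x y))) := by
  have hR := S.radius_pos i
  have hω := S.weight_nonneg i
  have hr0 := (S.centralAngle_nonneg i _ _).trans hr
  have hρ0 := (S.centralAngle_nonneg i _ _).trans hρ
  have hchord : ∀ {a b : ℂ}, a ∈ Metric.sphere (S.center i) (S.radius i) →
      b ∈ Metric.sphere (S.center i) (S.radius i) →
      dist a b ≤ S.radius i * S.centralAngle i a b := by
    intro a b ha hb
    rw [S.dist_eq_two_mul_sin_centralAngle i ha hb]
    have := sin_le (x := S.centralAngle i a b / 2) (by linarith [S.centralAngle_nonneg i a b])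
    nlinarith
  -- The walk imitates whichever of chord and arc realizes the crossing cost.
  rcases min_cases (S.weight i * (2 * S.radius i * sin (S.centralAngle i x y / 2)))
    (min 1 (S.weight i) * (S.radius i * S.centralAngle i x y)) with ⟨e, -⟩ | ⟨e, -⟩
  · refine (S.reach_chord hn hε hε' hnear u v).mono (ENNReal.ofReal_le_ofReal ?_)
    rw [crossing, e, ← S.dist_eq_two_mul_sin_centralAngle i hx hy]
    have hd : dist (u : ℂ) v ≤ S.radius i * (r + ρ) + dist x y := by
      have h1 := dist_triangle4 (u : ℂ) x y v
      have h2 := hchord (hsphere i u.2) hx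
      have h3 := hchord hy (hsphere i v.2)
      have h4 := mul_le_mul_of_nonneg_left hr hR.le
      have h5 := mul_le_mul_of_nonneg_left hρ hR.le
      linarith
    have hK : 0 ≤ min (π / 2) (1 + ε) := le_min (by positivity) (by positivity)
    calc min (π / 2) (1 + ε) * (S.weight i * dist (u : ℂ) v)
        ≤ min (π / 2) (1 + ε) * (S.weight i * (S.radius i * (r + ρ) + dist x y)) := by gcongr
      _ = min (π / 2) (1 + ε) * S.weight i * (S.radius i * (r + ρ)) +
          min (π / 2) (1 + ε) * (S.weight i * dist x y) := by ring
      _ ≤ _ := by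
        gcongr
        · exact min_le_left _ _
        · exact min_le_right _ _
  · refine (S.reach_arc hfin hsphere u v).mono (ENNReal.ofReal_le_ofReal ?_)
    rw [crossing, e]
    have hm : 0 ≤ min 1 (S.weight i) := le_min zero_le_one hω
    have hm' : min 1 (S.weight i) ≤ S.weight i := min_le_right _ _
    have ht : S.centralAngle i u v ≤ (r + ρ) + S.centralAngle i x y := by
      have h1 := S.centralAngle_triangle i u x v
      have h2 := S.centralAngle_triangle i x y v
      linarith
    have hxy := S.centralAngle_nonneg i x y
    calc min 1 (S.weight i) * (S.radius i * S.centralAngle i u v)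
        ≤ min 1 (S.weight i) * (S.radius i * ((r + ρ) + S.centralAngle i x y)) := by gcongr
      _ = 1 * min 1 (S.weight i) * (S.radius i * (r + ρ)) +
          1 * (min 1 (S.weight i) * (S.radius i * S.centralAngle i x y)) := by ring
      _ ≤ _ := by
        gcongr
        · linarith [pi_gt_three]
        · linarith

/-- Moving the endpoints of a portion of a path between two disks to nodes. -/
theorem reach_outside {x y : ℂ} (γ : RectifiablePath x y) {i j : Fin n} (hij : i ≠ j) {a b : ℝ}
    (hab : a ≤ b) {θ θ' χ χ' : ℝ} (ha : γ.toPath.extend a = S.pt i θ)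
    (hb : γ.toPath.extend b = S.pt j θ')
    (hout : ∀ τ ∈ Ioo a b, ∀ k, γ.toPath.extend τ ∉
      Metric.closedBall (S.center k) (S.radius k))
    (hu : S.pt i (θ + χ) ∈ V i) (hv : S.pt j (θ' + χ') ∈ V j) :
    S.Reach (⟨i, _, hu⟩ : Node V) ⟨j, _, hv⟩
      (ENNReal.ofReal (S.radius i * |χ|) +
        (γ.arcLength (Ioo a b) + ENNReal.ofReal (S.radius j * |χ'|))) := by
  refine Reach.of_edgeWeight_le fun _ ↦ ?_
  rw [edgeWeight, if_neg hij]
  split_ifs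
  · rw [← edist_dist]
    refine (edist_triangle4 _ (S.pt i θ) (S.pt j θ') _).trans ?_
    rw [add_assoc]
    refine add_le_add ?_ (add_le_add ?_ ?_)
    · rw [edist_dist]
      exact ENNReal.ofReal_le_ofReal (S.dist_pt_le i θ χ)
    · rw [← ha, ← hb]
      exact γ.edist_le_arcLength_Ioo hab
    · rw [edist_dist, dist_comm]
      exact ENNReal.ofReal_le_ofReal (S.dist_pt_le j θ' χ')
  · exact S.detourLength_le γ hab ha hb hout

end WeightedDisks

end

/-! ### Following a path from disk to disk -/

section

open Set Filter Topology

namespace WeightedDisks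

variable {n : ℕ} (S : WeightedDisks n) {V : Fin n → Set ℂ} {x y : ℂ} (γ : RectifiablePath x y)

theorem exists_pos_le_gap (hn : 2 ≤ n) : ∃ D > 0, ∀ i, D ≤ S.gap i := by
  have : Nonempty (Fin n) := ⟨⟨0, by omega⟩⟩
  obtain ⟨k, hk⟩ := Finite.exists_min S.gap
  exact ⟨S.gap k, S.gap_pos hn k, hk⟩

theorem centralAngle_self {i : Fin n} {z : ℂ}
    (hz : z ∈ Metric.sphere (S.center i) (S.radius i)) : S.centralAngle i z z = 0 := by
  refine InnerProductGeometry.angle_self (sub_ne_zero.2 ?_)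
  rintro rfl
  rw [Metric.mem_sphere, dist_self] at hz
  exact (S.radius_pos i).ne hz

theorem notMem_closedBall_of_ne {i j : Fin n} (hij : i ≠ j) {z : ℂ}
    (hz : z ∈ Metric.closedBall (S.center i) (S.radius i)) :
    z ∉ Metric.closedBall (S.center j) (S.radius j) :=
  Set.disjoint_left.1 (S.disjoint i j hij) hz

/-- If a path is in the `i`-th disk at time `a` and touches another disk later, then there are a
first time `f` after `a` in another disk and a last time `g` before `f` in the `i`-th disk. -/
theorem exists_leave {i : Fin n} {a : ℝ}
    (ha : γ.toPath.extend a ∈ Metric.closedBall (S.center i) (S.radius i))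
    (h : ∃ τ ∈ Icc a 1, ∃ j ≠ i,
      γ.toPath.extend τ ∈ Metric.closedBall (S.center j) (S.radius j)) :
    ∃ g f, a ≤ g ∧ g < f ∧ f ≤ 1 ∧ ∃ j ≠ i,
      γ.toPath.extend g ∈ Metric.sphere (S.center i) (S.radius i) ∧
      γ.toPath.extend f ∈ Metric.sphere (S.center j) (S.radius j) ∧
      (∀ τ ∈ Icc a g, ∀ k ≠ i, γ.toPath.extend τ ∉
        Metric.closedBall (S.center k) (S.radius k)) ∧
      ∀ τ ∈ Ioo g f, ∀ k, γ.toPath.extend τ ∉ Metric.closedBall (S.center k) (S.radius k) := by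
  have hcl : ∀ k, IsClosed
      (γ.toPath.extend ⁻¹' Metric.closedBall (S.center k) (S.radius k)) :=
    fun k ↦ Metric.isClosed_closedBall.preimage γ.continuous_extend
  have hop : ∀ k, IsOpen (γ.toPath.extend ⁻¹' Metric.ball (S.center k) (S.radius k)) :=
    fun k ↦ Metric.isOpen_ball.preimage γ.continuous_extend
  have hK : IsClosed (⋃ k : {k // k ≠ i},
      γ.toPath.extend ⁻¹' Metric.closedBall (S.center k) (S.radius k)) :=
    isClosed_iUnion_of_finite fun k ↦ hcl k
  obtain ⟨τ₀, hτ₀, j₀, hj₀, hmem₀⟩ := h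
  obtain ⟨f, ⟨hf, hfK⟩, hfmin⟩ := (isCompact_Icc.inter_right hK).exists_isLeast
    ⟨τ₀, hτ₀, mem_iUnion.2 ⟨⟨j₀, hj₀⟩, hmem₀⟩⟩
  obtain ⟨⟨j, hj⟩, hfj⟩ := mem_iUnion.1 hfK
  have hno : ∀ τ, a ≤ τ → τ < f → ∀ k ≠ i,
      γ.toPath.extend τ ∉ Metric.closedBall (S.center k) (S.radius k) := by
    intro τ h1 h2 k hk hmem
    exact absurd (hfmin ⟨⟨h1, h2.le.trans hf.2⟩, mem_iUnion.2 ⟨⟨k, hk⟩, hmem⟩⟩) (not_le.2 h2)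
  obtain ⟨g, ⟨hg, hgi⟩, hgmax⟩ := ((isCompact_Icc (a := a) (b := f)).inter_right
    (hcl i)).exists_isGreatest ⟨a, ⟨le_rfl, hf.1⟩, ha⟩
  have hgf : g < f := by
    refine hg.2.lt_of_ne ?_
    rintro rfl
    exact S.notMem_closedBall_of_ne hj hfj hgi
  have hout : ∀ τ ∈ Ioo g f, ∀ k,
      γ.toPath.extend τ ∉ Metric.closedBall (S.center k) (S.radius k) := by
    intro τ hτ k
    rcases eq_or_ne k i with rfl | hk
    · intro hmem
      exact absurd (hgmax ⟨⟨hg.1.trans hτ.1.le, hτ.2.le⟩, hmem⟩) (not_le.2 hτ.1)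
    · exact hno τ (hg.1.trans hτ.1.le) hτ.2 k hk
  refine ⟨g, f, hg.1, hgf, hf.2, j, hj, ?_, ?_, fun τ hτ ↦ hno τ hτ.1 (hτ.2.trans_lt hgf), hout⟩
  · rw [← Metric.closedBall_sdiff_ball]
    refine ⟨hgi, fun hb ↦ ?_⟩
    -- A point in the open disk at time `g` would keep the path in it shortly afterwards.
    have h1 : ∀ᶠ τ in 𝓝[>] g, γ.toPath.extend τ ∈ Metric.ball (S.center i) (S.radius i) :=
      nhdsWithin_le_nhds ((hop i).mem_nhds hb)
    obtain ⟨τ, h2, h3⟩ := (h1.and (Ioo_mem_nhdsGT hgf)).exists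
    exact hout τ h3 i (Metric.ball_subset_closedBall h2)
  · rw [← Metric.closedBall_sdiff_ball]
    refine ⟨hfj, fun hb ↦ ?_⟩
    have h1 : ∀ᶠ τ in 𝓝[<] f, γ.toPath.extend τ ∈ Metric.ball (S.center j) (S.radius j) :=
      nhdsWithin_le_nhds ((hop j).mem_nhds hb)
    obtain ⟨τ, h2, h3⟩ := (h1.and (Ioo_mem_nhdsLT hgf)).exists
    exact hout τ h3 j (Metric.ball_subset_closedBall h2)

/-- The additive term is the inside cost of having started at `v` instead of the true point on the
path; it is paid by the outside portion that precedes time `a`. Induction is on the time left in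
units of `δ`. -/
theorem reach_end (hn : 2 ≤ n) (hweight : ∀ i, S.weight i ≤ π / 2) {ε : ℝ} (hε : 0 < ε)
    (hε' : ∀ i, 0 < S.weight i → ε ≤ S.aConst * π / (2 * S.weight i))
    (hfin : ∀ i, (V i).Finite)
    (hsphere : ∀ i, V i ⊆ Metric.sphere (S.center i) (S.radius i))
    (hnear : ∀ i θ, ∃ χ, |χ| ≤ S.snapAngle ε i ∧ S.pt i (θ + χ) ∈ V i)
    (t : Node V) (γ : RectifiablePath x (t.2 : ℂ)) {D δ : ℝ} (hD : ∀ i, D ≤ S.gap i)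
    (hclose : ∀ a b : ℝ, |a - b| ≤ δ → dist (γ.toPath.extend a) (γ.toPath.extend b) < D)
    (N : ℕ) : ∀ a ≤ 1, 1 - a < N * δ → ∀ (i : Fin n) (v : V i) (r : ℝ),
      γ.toPath.extend a ∈ Metric.sphere (S.center i) (S.radius i) →
      S.centralAngle i v (γ.toPath.extend a) ≤ r →
      S.Reach (⟨i, v⟩ : Node V) t (ENNReal.ofReal (π / 2 * S.weight i * (S.radius i * r)) +
        ENNReal.ofReal (1 + ε) * S.weightedMeasure γ (Ioc a 1)) := by
  induction N with
  | zero => intro a ha hN; simp at hN; linarith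
  | succ N ih =>
    intro a ha hN i v r hai hr
    have hR := S.radius_pos i
    have hω := S.weight_nonneg i
    have hr0 := (S.centralAngle_nonneg i _ _).trans hr
    have hdist : S.radius i ≤ dist (γ.toPath.extend a) (S.center i) := (Metric.mem_sphere.1 hai).ge
    by_cases htouch : ∃ τ ∈ Icc a 1, ∃ j ≠ i,
      γ.toPath.extend τ ∈ Metric.closedBall (S.center j) (S.radius j)
    · obtain ⟨g, f, hag, hgf, hf1, j, hj, hgi, hfj, hno, hout⟩ :=
        S.exists_leave γ (Metric.sphere_subset_closedBall hai) htouch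
      obtain ⟨θ, hθ⟩ := S.exists_pt_eq i hgi
      obtain ⟨θ', hθ'⟩ := S.exists_pt_eq j hfj
      obtain ⟨χ, hχ, hu⟩ := hnear i θ
      obtain ⟨χ', hχ', hw⟩ := hnear j θ'
      have hRj := S.radius_pos j
      have hωj := S.weight_nonneg j
      have hs := S.snapAngle_nonneg hn hε i
      have hs' := S.snapAngle_nonneg hn hε j
      have hgap : S.gap i ≤ dist (γ.toPath.extend g) (γ.toPath.extend f) :=
        S.gap_le_dist hj.symm (Metric.sphere_subset_closedBall hgi)
          (Metric.sphere_subset_closedBall hfj)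
      have hgap' : S.gap j ≤ dist (γ.toPath.extend g) (γ.toPath.extend f) := by
        rw [dist_comm]
        exact S.gap_le_dist hj (Metric.sphere_subset_closedBall hfj)
          (Metric.sphere_subset_closedBall hgi)
      -- The outside portion spans a gap of at least `D`, hence takes more than `δ` of time.
      have hδ : δ < f - g := by
        by_contra! hcon
        have := hclose g f (by rw [abs_sub_comm, abs_of_pos (by linarith)]; exact hcon)
        linarith [hD i]
      have h1 := S.reach_crossing hn hε hε' hfin hsphere (hnear i) v ⟨_, hu⟩ hai hgi hr
        (ρ := S.snapAngle ε i) (by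
          rw [← hθ, S.centralAngle_comm]
          exact (S.centralAngle_pt_le i θ χ).trans hχ)
      have h2 := S.reach_outside γ hj.symm hgf.le hθ.symm hθ'.symm hout hu hw
      have h3 := ih f hf1 (by push_cast at hN; linarith) j ⟨_, hw⟩ (S.snapAngle ε j) hfj (by
        rw [← hθ']
        exact (S.centralAngle_pt_le j θ' χ').trans hχ')
      have hcross := S.crossing_le_weightedMeasure γ i hag hdist (Metric.mem_sphere.1 hgi).ge hno
      have hcr0 := S.crossing_nonneg i (S.centralAngle_nonneg i (γ.toPath.extend a)
        (γ.toPath.extend g)) (S.centralAngle_le_pi i _ _)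
      have hL : γ.arcLength (Ioo g f) ≤ S.weightedMeasure γ (Ioc g f) :=
        (S.arcLength_le_weightedMeasure γ measurableSet_Ioo hout).trans
          (MeasureTheory.measure_mono Ioo_subset_Ioc_self)
      -- Moving one endpoint costs on both sides of the circle: inside at rate `π / 2 * ω`, outside
      -- at rate `1`. Together this takes at most `ε / 2` of the outside portion.
      have hpay : ∀ (k : Fin n) (ψ : ℝ), |ψ| ≤ S.snapAngle ε k →
          S.gap k ≤ dist (γ.toPath.extend g) (γ.toPath.extend f) →
          ENNReal.ofReal (π / 2 * S.weight k * (S.radius k * S.snapAngle ε k)) +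
          ENNReal.ofReal (S.radius k * |ψ|) ≤ ENNReal.ofReal (ε / 2) * γ.arcLength (Ioo g f) := by
        intro k ψ hψ hk
        have hRk := S.radius_pos k
        have hωk := S.weight_nonneg k
        have hsk := S.snapAngle_nonneg hn hε k
        have hcost := S.snap_cost_le hn hε hweight k
        have h5 : S.radius k * |ψ| ≤ S.radius k * S.snapAngle ε k := by gcongr
        have h6 : ε / 2 * S.gap k ≤ ε / 2 * dist (γ.toPath.extend g) (γ.toPath.extend f) := by
          gcongr
        rw [← ENNReal.ofReal_add (by positivity) (by positivity)]
        calc _ ≤ ENNReal.ofReal (ε / 2 * dist (γ.toPath.extend g) (γ.toPath.extend f)) :=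
              ENNReal.ofReal_le_ofReal (by linarith)
          _ = ENNReal.ofReal (ε / 2) * edist (γ.toPath.extend g) (γ.toPath.extend f) := by
              rw [ENNReal.ofReal_mul (by positivity), edist_dist]
          _ ≤ _ := by
              gcongr
              exact γ.edist_le_arcLength_Ioo hgf.le
      have hp := hpay i χ hχ hgap
      have hp' := hpay j χ' hχ' hgap'
      refine ((h1.trans h2).trans h3).mono ?_
      rw [mul_add (S.radius i), mul_add (π / 2 * S.weight i),
        ENNReal.ofReal_add (by positivity) (by positivity),
        ENNReal.ofReal_add (by positivity) (by positivity),
        ENNReal.ofReal_mul (p := 1 + ε) (by positivity),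
        ← S.weightedMeasure_Ioc_add γ hag (hgf.le.trans hf1),
        ← S.weightedMeasure_Ioc_add γ hgf.le hf1]
      have hone : ENNReal.ofReal (1 + ε) =
          1 + (ENNReal.ofReal (ε / 2) + ENNReal.ofReal (ε / 2)) := by
        rw [← ENNReal.ofReal_add (by positivity) (by positivity), ← ENNReal.ofReal_one,
          ← ENNReal.ofReal_add (by positivity) (by positivity)]
        congr 1
        ring
      have hmid : ENNReal.ofReal (π / 2 * S.weight i * (S.radius i * S.snapAngle ε i)) +
          ENNReal.ofReal (S.radius i * |χ|) + γ.arcLength (Ioo g f) +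
          (ENNReal.ofReal (π / 2 * S.weight j * (S.radius j * S.snapAngle ε j)) +
          ENNReal.ofReal (S.radius j * |χ'|)) ≤
          ENNReal.ofReal (1 + ε) * S.weightedMeasure γ (Ioc g f) := by
        refine le_trans ?_ (mul_le_mul_right hL _)
        refine (add_le_add (add_le_add_left hp _) hp').trans (le_of_eq ?_)
        rw [hone]
        ring
      have hfirst := mul_le_mul_right hcross (ENNReal.ofReal (1 + ε))
      rw [mul_add, mul_add]
      refine le_trans (le_of_eq ?_) (add_le_add_right (add_le_add hfirst
        (add_le_add_left hmid _)) _)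
      ring
    · push Not at htouch
      obtain ⟨k, w⟩ := t
      have hw := hsphere k w.2
      have hend : γ.toPath.extend 1 = w := γ.toPath.extend_one
      have hk : k = i := by
        by_contra hk
        exact htouch 1 ⟨ha, le_rfl⟩ k hk (by rw [hend]; exact Metric.sphere_subset_closedBall hw)
      subst hk
      -- The final point is a node, so nothing has to be moved there.
      have h1 := S.reach_crossing hn hε hε' hfin hsphere (hnear k) v w hai hw hr
        (ρ := 0) (S.centralAngle_self hw).le
      have hcross := S.crossing_le_weightedMeasure γ k ha hdist
        (by rw [hend]; exact (Metric.mem_sphere.1 hw).ge) htouch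
      rw [hend] at hcross
      refine h1.mono (ENNReal.ofReal_add_le.trans ?_)
      rw [add_zero, ENNReal.ofReal_mul (p := 1 + ε) (by positivity)]
      gcongr

theorem graphLength_bypass_le [DecidableEq (Node V)] {s t : Node V}
    (p : (⊤ : SimpleGraph (Node V)).Walk s t) : S.graphLength p.bypass ≤ S.graphLength p :=
  (p.darts_bypass_sublist_darts.map _).sum_le_sum fun _ _ ↦ zero_le

/-- Removing loops does not lengthen a walk, and there are only finitely many simple paths. -/
theorem exists_minimal_walk (hfin : ∀ i, (V i).Finite) (s t : Node V) :
    ∃ p : (⊤ : SimpleGraph (Node V)).Walk s t, ∀ q : (⊤ : SimpleGraph (Node V)).Walk s t,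
      S.graphLength p ≤ S.graphLength q := by
  classical
  have : ∀ i, Finite (V i) := hfin
  have : Fintype (Node V) := Fintype.ofFinite _
  obtain ⟨p₀, -⟩ : S.Reach s t ⊤ := Reach.of_edgeWeight_le fun _ ↦ le_top
  have : Nonempty ((⊤ : SimpleGraph (Node V)).Path s t) := ⟨p₀.toPath⟩
  obtain ⟨p, hp⟩ := Finite.exists_min fun p : (⊤ : SimpleGraph (Node V)).Path s t ↦
    S.graphLength p.1
  exact ⟨p.1, fun q ↦ (hp q.toPath).trans (S.graphLength_bypass_le q)⟩

theorem steinerPoints_subset_sphere (ε : ℝ) (θ₀ : Fin n → ℝ) (i : Fin n) :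
    S.steinerPoints ε θ₀ i ⊆ Metric.sphere (S.center i) (S.radius i) := by
  rintro z (⟨φ, -, rfl⟩ | ⟨-, φ, -, l, -, rfl | rfl⟩) <;> exact S.pt_mem_sphere i _

end WeightedDisks

end

theorem mainTheorem1 (n : ℕ) (hn : 2 ≤ n) (S : WeightedDisks n)
    (hweight : ∀ i, S.weight i ≤ Real.pi / 2)
    (ε : ℝ) (hε : 0 < ε)
    (hε' : ∀ i, 0 < S.weight i → ε ≤ S.aConst * Real.pi / (2 * S.weight i))
    (θ₀ : Fin n → ℝ) (V : Fin n → Set ℂ)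
    (hV : ∀ i, S.annularSteinerPoints ε θ₀ i ⊆ V i)
    (hV' : ∀ i, V i ⊆ S.steinerPoints ε θ₀ i)
    (s t : WeightedDisks.Node V) :
    ∃ p : (⊤ : SimpleGraph (WeightedDisks.Node V)).Walk s t,
      ∀ γ : RectifiablePath (s.2 : ℂ) (t.2 : ℂ),
        S.graphLength p ≤ ENNReal.ofReal (1 + ε) * S.weightedLength γ := by
  have hfin : ∀ i, (V i).Finite := fun i ↦
    (S.finite_steinerPoints hn hε hε' θ₀ i).subset (hV' i)
  have hsphere : ∀ i, V i ⊆ Metric.sphere (S.center i) (S.radius i) := fun i ↦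
    (hV' i).trans (S.steinerPoints_subset_sphere ε θ₀ i)
  have hnear : ∀ i θ, ∃ χ, |χ| ≤ S.snapAngle ε i ∧ S.pt i (θ + χ) ∈ V i := fun i θ ↦
    (S.exists_pt_near hn hε hε' θ₀ i θ).imp fun χ h ↦ ⟨h.1, hV i h.2⟩
  -- The walk is fixed before the path `γ`; the walk built along `γ` only serves for comparison.
  obtain ⟨p, hp⟩ := S.exists_minimal_walk hfin s t
  refine ⟨p, fun γ ↦ ?_⟩
  obtain ⟨D, hD0, hD⟩ := S.exists_pos_le_gap hn
  obtain ⟨δ, hδ, hclose⟩ := γ.exists_dist_extend_le hD0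
  obtain ⟨N, hN⟩ := exists_nat_gt (1 / δ)
  rw [div_lt_iff₀ hδ] at hN
  have hs := hsphere s.1 s.2.2
  have hstart : γ.toPath.extend 0 = s.2 := γ.toPath.extend_zero
  obtain ⟨q, hq⟩ := S.reach_end hn hweight hε hε' hfin hsphere hnear t γ hD hclose N 0
    zero_le_one (by linarith) s.1 s.2 0 (by rwa [hstart]) (by rw [hstart, S.centralAngle_self hs])
  refine (hp q).trans (hq.trans ?_)
  rw [mul_zero, mul_zero, ENNReal.ofReal_zero, zero_add, ← S.weightedMeasure_univ γ]
  gcongr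
  exact Set.subset_univ _
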